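/- Let $a,b\in\mathbb C$. Let $CSV(a,b)$ be the Lie conformal algebra with $\mathbb C[\partial]$-basis $\{L_i,M_i,Y_i\mid i\in\mathbb Z\}$ and $\lambda$-brackets $$[L_i\,{}_\lambda L_j]=(\partial+2\lambda)L_{i+j},\quad [L_i\,{}_\lambda M_j]=(\partial+a\lambda+b)M_{i+j},$$ $$[L_i\,{}_\lambda Y_j]=\left(\partial+\left(\tfrac a2+1\right)\lambda+\tfrac b2\right)Y_{i+j},\quad [Y_i\,{}_\lambda Y_j]=(\partial+2\lambda)M_{i+j},$$ where $[M_i\,{}_\lambda M_j]=[M_i\,{}_\lambda Y_j]=0$ and the remaining brackets are given by skew-symmetry. It is $\mathbb Z$-graded with degree $i$ part $\mathbb C[\partial]L_i\oplus\mathbb C[\partial]M_i\oplus\mathbb C[\partial]Y_i$. A $\mathbb Z$-graded free intermediate series module over $CSV(a,b)$ is a conformal module $V=\bigoplus_{m\in\mathbb Z}V_m$, graded compatibly with $CSV(a,b)$, in which every $V_m$ is a $\mathbb C[\partial]$-submodule freely generated over $\mathbb C[\partial]$ by one element. It is nontrivial if its $\lambda$-action is not identically zero. For $\alpha,\beta,d\in\mathbb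 C$ and a sequence $A=(a_m)_{m\in\mathbb Z}$ with $a_m\in\{0,1\}$, define $\lambda$-actions on $\bigoplus_{m\in\mathbb Z}\mathbb C[\partial]v_m$ as follows. * $V_{\alpha,\beta,d}$: $\ L_i\,{}_\lambda v_m=(\partial+\alpha\lambda+\beta)v_{i+m}$, $\ M_i\,{}_\lambda v_m=0$, $\ Y_i\,{}_\lambda v_m=d\,v_{i+m}$. * $V_{A,\beta,d}$: $\ M_i\,{}_\lambda v_m=0$, $\ Y_i\,{}_\lambda v_m=d\,v_{i+m}$, and $L_i\,{}_\lambda v_m$ equals $(\partial+\beta)v_{i+m}$, $(\partial+\beta+\lambda)v_{i+m}$, $v_{i+m}$, $(\partial+\beta)(\partial+\beta+\lambda)v_{i+m}$ if $(a_m,a_{i+m})$ is $(0,0)$, $(1,1)$, $(0,1)$, $(1,0)$, respectively. Put $V_{\alpha,\beta}=V_{\alpha,\beta,0}$ and $V_{A,\beta}=V_{A,\beta,0}$ (so $M_i$ and $Y_i$ act trivially). Let $V$ be a nontrivial $\mathbb Z$-graded free intermediate series module over $CSV(a,b)$. 1. If $a\ne0$ or $b\ne0$, then $V\cong V_{\alpha,\beta}$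 for some $\alpha,\beta\in\mathbb C$, or $V\cong V_{A,\beta}$ for some $A\in\{0,1\}^{\mathbb Z}$, $\beta\in\mathbb C$. 2. If $a=b=0$, then $V\cong V_{\alpha,\beta,d}$ for some $\alpha,\beta,d\in\mathbb C$, or $V\cong V_{A,\beta,d}$ for some $A\in\{0,1\}^{\mathbb Z}$, $\beta,d\in\mathbb C$, where $d=0$ or the sequence $A$ is constant. The isomorphisms are isomorphisms of conformal modules that preserve the grading. Conversely, for all $a,b$, every $V_{\alpha,\beta}$ and every $V_{A,\beta}$ is a nontrivial $\mathbb Z$-graded free intermediate series module over $CSV(a,b)$; if $a=b=0$, then so is every $V_{\alpha,\beta,d}$, while $V_{A,\beta,d}$ is one if and only if $d=0$ or $A$ is constant. -/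

import Mathlib

open Polynomial

noncomputable section

/-- A function `f : ℂ → V`, `λ ↦ f λ`, is given by an element of `V[λ] = ℂ[λ] ⊗ V`.  As `ℂ` is
infinite, the polynomial is determined by its values, so that `V[λ]` is the same thing as the
space of these functions, and an identity in `V[λ]` or `V[λ, μ]` is an identity between values at
all complex `λ, μ`. -/
def IsPolynomialFamily {V : Type*} [AddCommGroup V] [Module ℂ V] (f : ℂ → V) : Prop :=
  ∃ P : ℕ →₀ V, ∀ t : ℂ, f t = P.sum fun n v => t ^ n • v

/-- A Lie conformal algebra structure on the `ℂ[∂]`-module `R` (here `∂ = X`).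
`bracket t a b` is the value of `[a_λ b]` at `λ = t`. -/
structure LieConformalAlgebra (R : Type*) [AddCommGroup R] [Module ℂ R] [Module ℂ[X] R]
    [IsScalarTower ℂ ℂ[X] R] where
  bracket : ℂ → R →ₗ[ℂ] R →ₗ[ℂ] R
  polynomial : ∀ a b, IsPolynomialFamily fun t => bracket t a b
  /-- `[∂a_λ b] = -λ [a_λ b]` -/
  sesq_left : ∀ t a b, bracket t ((X : ℂ[X]) • a) b = -(t • bracket t a b)
  /-- `[a_λ ∂b] = (∂ + λ) [a_λ b]` -/
  sesq_right : ∀ t a b, bracket t a ((X : ℂ[X]) • b) = (X + C t : ℂ[X]) • bracket t a b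
  /-- `[a_λ b] = -[b_{-λ-∂} a]`: if `[b_λ a] = ∑ λⁿ Pₙ`, then `[a_λ b] = -∑ (-λ-∂)ⁿ Pₙ`. -/
  skew : ∀ (a b : R) (P : ℕ →₀ R), (∀ t, bracket t b a = P.sum fun n r => t ^ n • r) →
    ∀ t, bracket t a b = -(P.sum fun n r => ((-C t - X : ℂ[X]) ^ n) • r)
  /-- `[a_λ [b_μ c]] = [[a_λ b]_{λ+μ} c] + [b_μ [a_λ c]]` -/
  jacobi : ∀ s t a b c, bracket s a (bracket t b c) =
    bracket (s + t) (bracket s a b) c + bracket t b (bracket s a c)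

/-- `act` makes `V` a conformal module over the Lie conformal algebra `S`;
`act t r v` is the value of `r_λ v` at `λ = t`. -/
structure IsConformalModule {R V : Type*} [AddCommGroup R] [Module ℂ R] [Module ℂ[X] R]
    [IsScalarTower ℂ ℂ[X] R] [AddCommGroup V] [Module ℂ V] [Module ℂ[X] V]
    [IsScalarTower ℂ ℂ[X] V] (S : LieConformalAlgebra R) (act : ℂ → R →ₗ[ℂ] V →ₗ[ℂ] V) :
    Prop where
  polynomial : ∀ r v, IsPolynomialFamily fun t => act t r v
  /-- `(∂r)_λ v = -λ r_λ v` -/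
  sesq_left : ∀ t r v, act t ((X : ℂ[X]) • r) v = -(t • act t r v)
  /-- `r_λ (∂v) = (∂ + λ) r_λ v` -/
  sesq_right : ∀ t r v, act t r ((X : ℂ[X]) • v) = (X + C t : ℂ[X]) • act t r v
  /-- `a_λ (b_μ v) - b_μ (a_λ v) = [a_λ b]_{λ+μ} v` -/
  commutator : ∀ s t a b v, act s a (act t b v) - act t b (act s a v) =
    act (s + t) (S.bracket s a b) v

/-- With respect to the grading `RR` of the Lie conformal algebra `S` and the grading `VV` of `V`,
the action makes `V` a `ℤ`-graded free intermediate series module. -/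
structure IsGradedFreeIntermediateSeries {R V : Type*} [AddCommGroup R] [Module ℂ R]
    [Module ℂ[X] R] [IsScalarTower ℂ ℂ[X] R] [AddCommGroup V] [Module ℂ V] [Module ℂ[X] V]
    [IsScalarTower ℂ ℂ[X] V] (S : LieConformalAlgebra R) (RR : ℤ → Submodule ℂ[X] R)
    (act : ℂ → R →ₗ[ℂ] V →ₗ[ℂ] V) (VV : ℤ → Submodule ℂ[X] V) : Prop where
  isConformalModule : IsConformalModule S act
  isInternal : DirectSum.IsInternal VV
  act_mem : ∀ i j, ∀ r ∈ RR i, ∀ v ∈ VV j, ∀ t, act t r v ∈ VV (i + j)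
  /-- every `VV i` is freely generated over `ℂ[∂]` by one element -/
  free_one : ∀ i, ∃ v : V, VV i = Submodule.span ℂ[X] {v} ∧ ∀ p : ℂ[X], p • v = 0 → p = 0

/-- The `λ`-action is not identically zero. -/
def IsNontrivialAction {R V : Type*} [AddCommGroup R] [Module ℂ R] [AddCommGroup V] [Module ℂ V]
    (act : ℂ → R →ₗ[ℂ] V →ₗ[ℂ] V) : Prop :=
  ∃ t r v, act t r v ≠ 0

/-- An isomorphism of conformal modules which respects the gradings. -/
def GradedConformalIso {R V W : Type*} [AddCommGroup R] [Module ℂ R]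
    [AddCommGroup V] [Module ℂ V] [Module ℂ[X] V] [AddCommGroup W] [Module ℂ W] [Module ℂ[X] W]
    (actV : ℂ → R →ₗ[ℂ] V →ₗ[ℂ] V) (VV : ℤ → Submodule ℂ[X] V)
    (actW : ℂ → R →ₗ[ℂ] W →ₗ[ℂ] W) (WW : ℤ → Submodule ℂ[X] W) : Prop :=
  ∃ e : V ≃ₗ[ℂ[X]] W, (∀ t r v, e (actV t r v) = actW t r (e v)) ∧
    ∀ m, (VV m).map (e : V →ₗ[ℂ[X]] W) = WW m

/-- Extension of values `K x y` on bases `x ∈ G`, `y ∈ B` of free `ℂ[∂]`-modules by conformal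
sesquilinearity, at `λ = t`: `(p(∂) x)_λ (q(∂) y) = p(-λ) q(∂ + λ) (x_λ y)`. -/
def sesqExt {G B : Type*} (t : ℂ) (K : G → B → (B →₀ ℂ[X])) :
    (G →₀ ℂ[X]) →ₗ[ℂ] (B →₀ ℂ[X]) →ₗ[ℂ] (B →₀ ℂ[X]) :=
  LinearMap.mk₂ ℂ
    (fun r v => r.sum fun x p => v.sum fun y q => (C (p.eval (-t)) * q.comp (X + C t)) • K x y)
    (by
      intro r s v
      refine Finsupp.sum_add_index' (by simp) ?_
      intro x p q
      simp [add_mul, add_smul])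
    (by
      intro c r v
      rw [Finsupp.sum_smul_index' (by simp), Finsupp.smul_sum]
      refine Finsupp.sum_congr fun x _ => ?_
      rw [Finsupp.smul_sum]
      refine Finsupp.sum_congr fun y _ => ?_
      rw [eval_smul, ← smul_assoc, smul_eq_mul, C_mul, smul_eq_C_mul, mul_assoc])
    (by
      intro r v w
      rw [← Finsupp.sum_add]
      refine Finsupp.sum_congr fun x _ => ?_
      refine Finsupp.sum_add_index' (by simp) ?_
      intro y p q
      simp [mul_add, add_smul])
    (by
      intro c r v
      rw [Finsupp.smul_sum]
      refine Finsupp.sum_congr fun x _ => ?_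
      rw [Finsupp.sum_smul_index' (by simp), Finsupp.smul_sum]
      refine Finsupp.sum_congr fun y _ => ?_
      rw [smul_comp, ← smul_assoc, mul_smul_comm])

theorem sesqExt_apply {G B : Type*} (t : ℂ) (K : G → B → (B →₀ ℂ[X])) (r : G →₀ ℂ[X])
    (v : B →₀ ℂ[X]) : sesqExt t K r v =
      r.sum fun x p => v.sum fun y q => (C (p.eval (-t)) * q.comp (X + C t)) • K x y := rfl

theorem sesqExt_single {G B : Type*} (t : ℂ) (K : G → B → (B →₀ ℂ[X])) (x : G) (y : B)
    (p q : ℂ[X]) : sesqExt t K (Finsupp.single x p) (Finsupp.single y q) =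
      (C (p.eval (-t)) * q.comp (X + C t)) • K x y := by
  simp [sesqExt_apply]

theorem sesqExt_X_left {G B : Type*} (t : ℂ) (K : G → B → (B →₀ ℂ[X])) (r : G →₀ ℂ[X])
    (v : B →₀ ℂ[X]) :
    sesqExt t K ((X : ℂ[X]) • r) v = -(t • sesqExt t K r v) := by
  rw [sesqExt_apply, sesqExt_apply, Finsupp.sum_smul_index' (by simp), Finsupp.smul_sum,
    Finsupp.sum, Finsupp.sum, ← Finset.sum_neg_distrib]
  refine Finset.sum_congr rfl fun x _ => ?_
  rw [Finsupp.smul_sum, Finsupp.sum, Finsupp.sum, ← Finset.sum_neg_distrib]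
  refine Finset.sum_congr rfl fun y _ => ?_
  rw [← smul_assoc, ← neg_smul]
  congr 1
  simp [smul_eq_C_mul]
  ring

theorem sesqExt_X_right {G B : Type*} (t : ℂ) (K : G → B → (B →₀ ℂ[X])) (r : G →₀ ℂ[X])
    (v : B →₀ ℂ[X]) :
    sesqExt t K r ((X : ℂ[X]) • v) = (X + C t : ℂ[X]) • sesqExt t K r v := by
  rw [sesqExt_apply, sesqExt_apply, Finsupp.smul_sum]
  refine Finsupp.sum_congr fun x _ => ?_
  rw [Finsupp.sum_smul_index' (by simp), Finsupp.smul_sum]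
  refine Finsupp.sum_congr fun y _ => ?_
  rw [← smul_assoc]
  congr 1
  simp
  ring

/-- The `ℂ[∂]`-basis `L_i, M_i, Y_i`, `i ∈ ℤ`, of `CSV(a,b)`. -/
inductive CSVGen : Type
  | L (i : ℤ) : CSVGen
  | M (i : ℤ) : CSVGen
  | Y (i : ℤ) : CSVGen

/-- The free `ℂ[∂]`-module that underlies `CSV(a,b)`. -/
abbrev CSVCarrier : Type := CSVGen →₀ ℂ[X]

/-- The brackets of the basis elements of `CSV(a,b)`, at `λ = t`.  The brackets `[M_i _λ L_j]` and
`[Y_i _λ L_j]` are those that skew-symmetry forces. -/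
def csvGenBracket (a b t : ℂ) : CSVGen → CSVGen → CSVCarrier
  | .L i, .L j => Finsupp.single (.L (i + j)) (X + C (2 * t))
  | .L i, .M j => Finsupp.single (.M (i + j)) (X + C (a * t + b))
  | .L i, .Y j => Finsupp.single (.Y (i + j)) (X + C ((a / 2 + 1) * t + b / 2))
  | .Y i, .Y j => Finsupp.single (.M (i + j)) (X + C (2 * t))
  | .M i, .L j => Finsupp.single (.M (i + j)) (-(X + C a * (-C t - X) + C b))
  | .Y i, .L j => Finsupp.single (.Y (i + j)) (-(X + C (a / 2 + 1) * (-C t - X) + C (b / 2)))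
  | .M _, .M _ => 0
  | .M _, .Y _ => 0
  | .Y _, .M _ => 0

theorem csv_induction {G : Type*} {p : (G →₀ ℂ[X]) → Prop} (h0 : p 0)
    (hadd : ∀ r s, p r → p s → p (r + s)) (hsmul : ∀ (c : ℂ) r, p r → p (c • r))
    (hX : ∀ r, p r → p ((X : ℂ[X]) • r)) (hgen : ∀ x, p (Finsupp.single x 1)) (r) : p r := by
  have key : ∀ (q : ℂ[X]) r, p r → p (q • r) := by
    intro q
    induction q using Polynomial.induction_on with
    | C c =>
      intro r hr
      have := hsmul c r hr
      rwa [show C c • r = c • r by rw [← algebraMap_smul ℂ[X] c r]; rfl]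
    | add f g hf hg =>
      intro r hr
      rw [add_smul]
      exact hadd _ _ (hf r hr) (hg r hr)
    | monomial n c ih =>
      intro r hr
      rw [pow_succ, ← mul_assoc, mul_smul]
      exact ih _ (hX r hr)
  induction r using Finsupp.induction_linear with
  | zero => exact h0
  | add f g hf hg => exact hadd _ _ hf hg
  | single x q =>
    have := key q _ (hgen x)
    simpa using this

theorem csv_jacobi (a b s t : ℂ) (x y z : CSVCarrier) :
    sesqExt s (csvGenBracket a b s) x (sesqExt t (csvGenBracket a b t) y z) =
      sesqExt (s + t) (csvGenBracket a b (s + t)) (sesqExt s (csvGenBracket a b s) x y) z +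
      sesqExt t (csvGenBracket a b t) y (sesqExt s (csvGenBracket a b s) x z) := by
  have hXC : ∀ (c : ℂ) (v : CSVCarrier), (X + C c : ℂ[X]) • v = (X : ℂ[X]) • v + c • v := by
    intro c v
    rw [add_smul, ← algebraMap_smul ℂ[X] c v]
    rfl
  induction x using csv_induction with
  | h0 => simp
  | hadd r q hr hq => simp only [map_add, LinearMap.add_apply, hr, hq]; abel
  | hsmul c r hr => simp only [map_smul, LinearMap.smul_apply, hr, smul_add]
  | hX r hr =>
    simp only [sesqExt_X_left, map_neg, map_smul, LinearMap.neg_apply, LinearMap.smul_apply, hr,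
      smul_add, neg_add]
  | hgen x =>
  induction y using csv_induction with
  | h0 => simp
  | hadd r q hr hq => simp only [map_add, LinearMap.add_apply, hr, hq]; abel
  | hsmul c r hr => simp only [map_smul, LinearMap.smul_apply, hr, smul_add]
  | hX r hr =>
    simp only [sesqExt_X_left, sesqExt_X_right, hXC, map_neg, map_smul, map_add,
      LinearMap.add_apply, LinearMap.smul_apply, hr, smul_add, neg_add]
    module
  | hgen y =>
  induction z using csv_induction with
  | h0 => simp
  | hadd r q hr hq => simp only [map_add, hr, hq]; abel
  | hsmul c r hr => simp only [map_smul, hr, smul_add]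
  | hX r hr =>
    simp only [sesqExt_X_right, hXC, map_smul, map_add, hr, smul_add]
    module
  | hgen z =>
  obtain ⟨a, rfl⟩ : ∃ a2 : ℂ, a = 2 * a2 := ⟨a / 2, by ring⟩
  obtain ⟨b, rfl⟩ : ∃ b2 : ℂ, b = 2 * b2 := ⟨b / 2, by ring⟩
  have ha : 2 * a / 2 = a := by ring
  have hb : 2 * b / 2 = b := by ring
  cases x <;> cases y <;> cases z <;> rename_i i j k <;>
    simp only [sesqExt_single, csvGenBracket, eval_one, one_comp, map_one, one_mul, one_smul,
      map_zero, LinearMap.zero_apply, smul_zero, add_zero, Finsupp.smul_single,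
      smul_eq_mul, ha, hb, show j + (i + k) = i + (j + k) by ring,
      show i + j + k = i + (j + k) by ring, ← Finsupp.single_add]
  all_goals
    congr 1
    simp only [eval_ofNat, ofNat_comp, eval_one, one_comp, eval_add, eval_sub, eval_neg, eval_mul, eval_X, eval_C, add_comp, sub_comp,
      neg_comp, mul_comp, X_comp, C_comp, C_mul, C_add,
      C_sub, C_neg, map_ofNat, map_one]
    ring

theorem csv_skew (a b : ℂ) (x y : CSVCarrier) : ∃ P : ℕ →₀ CSVCarrier,
    (∀ t, sesqExt t (csvGenBracket a b t) y x = P.sum fun n r => t ^ n • r) ∧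
    ∀ t, sesqExt t (csvGenBracket a b t) x y =
      -(P.sum fun n r => ((-C t - X : ℂ[X]) ^ n) • r) := by
  have hC : ∀ (c : ℂ) (v : CSVCarrier), (C c : ℂ[X]) • v = c • v := by
    intro c v
    rw [← algebraMap_smul ℂ[X] c v]
    rfl
  have hgen : ∀ x y : CSVGen, ∃ u v : CSVCarrier,
      (∀ t, csvGenBracket a b t y x = u + t • v) ∧
      ∀ t, csvGenBracket a b t x y = -(u + (-C t - X : ℂ[X]) • v) := by
    have aux : ∀ (g : CSVGen) (c d : ℂ) (p q : ℂ → ℂ[X]), (∀ t, p t = X + C c * C t + C d) →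
        (∀ t, q t = -(X + C c * (-C t - X) + C d)) → ∃ u v : CSVCarrier,
        (∀ t, Finsupp.single g (p t) = u + t • v) ∧
        ∀ t, Finsupp.single g (q t) = -(u + (-C t - X : ℂ[X]) • v) := by
      intro g c d p q hp hq
      refine ⟨Finsupp.single g (X + C d), Finsupp.single g (C c), fun t => ?_, fun t => ?_⟩
      · rw [Finsupp.smul_single, ← Finsupp.single_add, hp, smul_eq_C_mul]
        congr 1
        ring
      · rw [Finsupp.smul_single, ← Finsupp.single_add, ← Finsupp.single_neg, hq, smul_eq_mul]
        congr 1
        ring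
    have aux2 : ∀ (g : CSVGen) (c d : ℂ) (p q : ℂ → ℂ[X]), (∀ t, p t = X + C c * C t + C d) →
        (∀ t, q t = -(X + C c * (-C t - X) + C d)) → ∃ u v : CSVCarrier,
        (∀ t, Finsupp.single g (q t) = u + t • v) ∧
        ∀ t, Finsupp.single g (p t) = -(u + (-C t - X : ℂ[X]) • v) := by
      intro g c d p q hp hq
      refine ⟨Finsupp.single g (-X + C c * X - C d), Finsupp.single g (C c), fun t => ?_,
        fun t => ?_⟩
      · rw [Finsupp.smul_single, ← Finsupp.single_add, hq, smul_eq_C_mul]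
        congr 1
        ring
      · rw [Finsupp.smul_single, ← Finsupp.single_add, ← Finsupp.single_neg, hp, smul_eq_mul]
        congr 1
        ring
    intro x y
    cases x <;> cases y <;> rename_i i j <;>
      simp only [csvGenBracket, add_comm j i]
    case L.L | Y.Y => exact aux _ 2 0 _ _ (fun t => by simp) (fun t => by
      rw [C_mul, show (C 2 : ℂ[X]) = 2 from rfl, C_0]
      ring)
    case M.L => exact aux _ a b _ _ (fun t => by simp; ring) (fun t => rfl)
    case Y.L =>
      exact aux _ (a / 2 + 1) (b / 2) _ _ (fun t => by simp only [C_add, C_mul]; ring)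
        (fun t => rfl)
    case L.M => exact aux2 _ a b _ _ (fun t => by simp; ring) (fun t => rfl)
    case L.Y =>
      exact aux2 _ (a / 2 + 1) (b / 2) _ _ (fun t => by simp only [C_add, C_mul]; ring)
        (fun t => rfl)
    all_goals exact ⟨0, 0, by simp, by simp⟩
  let F : ℂ → (ℕ →₀ CSVCarrier) →ₗ[ℂ[X]] CSVCarrier := fun t =>
    Finsupp.lsum ℂ[X] fun n => (C t ^ n : ℂ[X]) • LinearMap.id
  let G : ℂ → (ℕ →₀ CSVCarrier) →ₗ[ℂ[X]] CSVCarrier := fun t =>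
    Finsupp.lsum ℂ[X] fun n => ((-C t - X) ^ n : ℂ[X]) • LinearMap.id
  have hF : ∀ t P, F t P = P.sum fun n r => t ^ n • r := by
    intro t P
    change (P.sum fun n r => (C t ^ n : ℂ[X]) • r) = _
    simp only [← C_pow, hC]
  have hG : ∀ t P, G t P = P.sum fun n r => ((-C t - X : ℂ[X]) ^ n) • r := fun t P => rfl
  simp only [← hF, ← hG]
  have hF1 : ∀ t n v, F t (Finsupp.single n v) = t ^ n • v := by
    intro t n v
    rw [hF]
    exact Finsupp.sum_single_index (smul_zero _)
  have hG1 : ∀ t n v, G t (Finsupp.single n v) = (-C t - X : ℂ[X]) ^ n • v := by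
    intro t n v
    rw [hG]
    exact Finsupp.sum_single_index (smul_zero _)
  let S : (ℕ →₀ CSVCarrier) →ₗ[ℂ[X]] (ℕ →₀ CSVCarrier) :=
    Finsupp.lmapDomain _ _ fun n => n + 1
  have hS1 : ∀ n v, S (Finsupp.single n v) = Finsupp.single (n + 1) v := by
    intro n v; simp [S]
  have hFS : ∀ t P, F t (S P) = t • F t P := by
    intro t P
    induction P using Finsupp.induction_linear with
    | zero => simp
    | add f g hf hg => simp only [smul_add, map_add, hf, hg]
    | single n v => rw [hS1, hF1, hF1, smul_smul, pow_succ']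
  have hGS : ∀ t P, G t (S P) = (-C t - X : ℂ[X]) • G t P := by
    intro t P
    induction P using Finsupp.induction_linear with
    | zero => simp
    | add f g hf hg => simp only [smul_add, map_add, hf, hg]
    | single n v => rw [hS1, hG1, hG1, smul_smul, pow_succ']
  induction x using csv_induction with
  | h0 => exact ⟨0, by simp, by simp⟩
  | hadd r q hr hq =>
    obtain ⟨P, hP, hP2⟩ := hr
    obtain ⟨Q, hQ, hQ2⟩ := hq
    refine ⟨P + Q, fun t => ?_, fun t => ?_⟩
    · simp only [map_add, hP, hQ]
    · simp only [map_add, LinearMap.add_apply, hP2, hQ2, neg_add]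
  | hsmul c r hr =>
    obtain ⟨P, hP, hP2⟩ := hr
    refine ⟨(C c : ℂ[X]) • P, fun t => ?_, fun t => ?_⟩
    · simp only [map_smul, hP, hC]
    · simp only [map_smul, LinearMap.smul_apply, hP2, hC, smul_neg]
  | hX r hr =>
    obtain ⟨P, hP, hP2⟩ := hr
    refine ⟨(X : ℂ[X]) • P + S P, fun t => ?_, fun t => ?_⟩
    · rw [sesqExt_X_right, hP, map_add, map_smul, hFS, add_smul, hC]
    · rw [sesqExt_X_left, hP2, map_add, map_smul, hGS, ← hC]
      module
  | hgen x =>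
  induction y using csv_induction with
  | h0 => exact ⟨0, by simp, by simp⟩
  | hadd r q hr hq =>
    obtain ⟨P, hP, hP2⟩ := hr
    obtain ⟨Q, hQ, hQ2⟩ := hq
    refine ⟨P + Q, fun t => ?_, fun t => ?_⟩
    · simp only [map_add, LinearMap.add_apply, hP, hQ]
    · simp only [map_add, hP2, hQ2, neg_add]
  | hsmul c r hr =>
    obtain ⟨P, hP, hP2⟩ := hr
    refine ⟨(C c : ℂ[X]) • P, fun t => ?_, fun t => ?_⟩
    · simp only [map_smul, LinearMap.smul_apply, hP, hC]
    · simp only [map_smul, hP2, hC, smul_neg]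
  | hX r hr =>
    obtain ⟨P, hP, hP2⟩ := hr
    refine ⟨(-1 : ℂ[X]) • S P, fun t => ?_, fun t => ?_⟩
    · rw [sesqExt_X_left, hP, map_smul, hFS, neg_one_smul]
    · rw [sesqExt_X_right, hP2, map_smul, hGS]
      module
  | hgen y =>
  obtain ⟨u, v, h1, h2⟩ := hgen x y
  refine ⟨Finsupp.single 0 u + Finsupp.single 1 v, fun t => ?_, fun t => ?_⟩
  · rw [sesqExt_single, h1, map_add, hF1, hF1]
    simp
  · rw [sesqExt_single, h2, map_add, hG1, hG1]
    simp

theorem polynomialFamily_unique {V : Type*} [AddCommGroup V] [Module ℂ V] (P Q : ℕ →₀ V)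
    (h : ∀ t : ℂ, (P.sum fun n v => t ^ n • v) = Q.sum fun n v => t ^ n • v) : P = Q := by
  classical
  have key : ∀ D : ℕ →₀ V, (∀ t : ℂ, (D.sum fun n v => t ^ n • v) = 0) → D = 0 := by
    intro D hD
    ext n
    rw [Finsupp.zero_apply, ← Module.forall_dual_apply_eq_zero_iff ℂ]
    intro φ
    have h0 : (∑ k ∈ D.support, monomial k (φ (D k)) : ℂ[X]) = 0 := by
      refine Polynomial.funext fun t => ?_
      have := congrArg φ (hD t)
      simp only [Finsupp.sum, map_sum, map_smul, smul_eq_mul, map_zero] at this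
      simp only [eval_finsetSum, eval_monomial, eval_zero]
      rw [← this]
      exact Finset.sum_congr rfl fun k _ => mul_comm _ _
    have h1 := congrArg (fun p => coeff p n) h0
    simp only [finsetSum_coeff, coeff_monomial, coeff_zero, Finset.sum_ite_eq',
      Finsupp.mem_support_iff] at h1
    by_cases hn : D n = 0
    · simp [hn]
    · simpa [hn] using h1
  rw [← sub_eq_zero]
  refine key _ fun t => ?_
  rw [Finsupp.sum_sub_index (fun n v w => smul_sub _ _ _), h t, sub_self]

/-- The Lie conformal algebra `CSV(a,b)`. -/
def CSV (a b : ℂ) : LieConformalAlgebra CSVCarrier where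
  bracket t := sesqExt t (csvGenBracket a b t)
  polynomial x y := by
    obtain ⟨P, hP, -⟩ := csv_skew a b y x
    exact ⟨P, hP⟩
  sesq_left t x y := sesqExt_X_left t _ x y
  sesq_right t x y := sesqExt_X_right t _ x y
  skew x y P hP := by
    obtain ⟨Q, hQ, hQ2⟩ := csv_skew a b x y
    have : P = Q := polynomialFamily_unique P Q fun t => (hP t).symm.trans (hQ t)
    rw [this]
    exact hQ2
  jacobi s t x y z := csv_jacobi a b s t x y z

/-- The degree `i` part `ℂ[∂]L_i ⊕ ℂ[∂]M_i ⊕ ℂ[∂]Y_i` of `CSV(a,b)`. -/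
def csvGrading (i : ℤ) : Submodule ℂ[X] CSVCarrier :=
  Submodule.span ℂ[X]
    {Finsupp.single (.L i) 1, Finsupp.single (.M i) 1, Finsupp.single (.Y i) 1}

/-- The free `ℂ[∂]`-module `⊕ ℂ[∂] v_m`, `m ∈ ℤ`, where `v_m = Finsupp.single m 1`. -/
abbrev SeriesCarrier : Type := ℤ →₀ ℂ[X]

/-- The grading of `⊕ ℂ[∂] v_m` with degree `m` part `ℂ[∂] v_m`. -/
def seriesGrading (m : ℤ) : Submodule ℂ[X] SeriesCarrier :=
  Submodule.span ℂ[X] {Finsupp.single m 1}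

/-- The sesquilinear extension of `L_i _λ v_m = f λ i m v_{i+m}`, `M_i _λ v_m = 0`,
`Y_i _λ v_m = d v_{i+m}`. -/
def seriesAction (f : ℂ → ℤ → ℤ → ℂ[X]) (d t : ℂ) :
    CSVCarrier →ₗ[ℂ] SeriesCarrier →ₗ[ℂ] SeriesCarrier :=
  sesqExt t fun x m => match x with
    | .L i => Finsupp.single (i + m) (f t i m)
    | .M _ => 0
    | .Y i => Finsupp.single (i + m) (C d)

/-- The `λ`-action of `V_{α,β,d}`: `L_i _λ v_m = (∂ + αλ + β) v_{i+m}`, `M_i _λ v_m = 0`,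
`Y_i _λ v_m = d v_{i+m}`. -/
def actVd (α β d : ℂ) : ℂ → CSVCarrier →ₗ[ℂ] SeriesCarrier →ₗ[ℂ] SeriesCarrier :=
  seriesAction (fun t _ _ => X + C (α * t + β)) d

/-- The coefficient of `L_i _λ v_m` in `V_{A,β}` at `λ = t`. -/
def coeffA (A : ℤ → Fin 2) (β t : ℂ) (i m : ℤ) : ℂ[X] :=
  match A m, A (i + m) with
  | 0, 0 => X + C β
  | 1, 1 => X + C β + C t
  | 0, 1 => 1
  | 1, 0 => (X + C β) * (X + C β + C t)

/-- The `λ`-action given by the formulas for `V_{A,β,d}`: `L_i _λ v_m = coeffA v_{i+m}`,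
`M_i _λ v_m = 0`, `Y_i _λ v_m = d v_{i+m}`. -/
def actAd (A : ℤ → Fin 2) (β d : ℂ) : ℂ → CSVCarrier →ₗ[ℂ] SeriesCarrier →ₗ[ℂ] SeriesCarrier :=
  seriesAction (fun t i m => coeffA A β t i m) d

/-- The `λ`-action of `V_{α,β}`, with `M_i` and `Y_i` acting trivially. -/
def actV (α β : ℂ) : ℂ → CSVCarrier →ₗ[ℂ] SeriesCarrier →ₗ[ℂ] SeriesCarrier := actVd α β 0

/-- The `λ`-action of `V_{A,β}`, with `M_i` and `Y_i` acting trivially. -/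
def actA (A : ℤ → Fin 2) (β : ℂ) : ℂ → CSVCarrier →ₗ[ℂ] SeriesCarrier →ₗ[ℂ] SeriesCarrier :=
  actAd A β 0

end

noncomputable section

/-! ### Polynomials in two variables -/

/-! A free generator in each degree turns the action of `L_i`, `M_i`, `Y_i` into families `P`, `G`,
`H` of polynomials in `∂` and `λ`, and the module axioms into functional equations. In `Q.evalEval s
x` the outer variable is `∂ = x` and the coefficients are polynomials in `λ = s`, so `natDegree` is
the degree in `∂`.

Virasoro part. Comparing top coefficients bounds the degree in `∂` (`natDegree_le_of_commutator`),
so `L_0` acts on a generator by zero or by `∂ + α_m λ + β_m` (`virasoro_rank_one`). As soon as one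
coefficient of `L` is nonzero, all are, and `β_m` is a constant `β` (`exists_weights`). Each `L_j`
then intertwines two rank one modules. Setting one parameter to zero yields an Euler equation, which
forces `1 + α_m - α_{j+m}` to be a natural number; the same for `L_{-j}` in the opposite direction
leaves a sum of two, and only equal weights or jumps between weights 0 and 1 survive
(`coefficient_cases`). The remaining scalars form a cocycle, which is removed by rescaling the basis
(`exists_rescaling`). This gives the `L`-action of `V_{α,β}` or of `V_{A,β}`.

The other generators. The degree bound makes `M_0` and `Y_0` free of `∂`; then `[Y_0, Y_0]` acts by
zero, so `M_0` and with it every `M_i` vanishes (`M_eq_zero`). Bracketing with `L_0` kills `Y_0`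
unless `a = b = 0`, where it is a constant `d`, and the bracket with `L_i` determines `Y_i` from
`d`. If `d ≠ 0`, commuting with `Y_0` makes `Y_i` free of `∂`, which is incompatible with the
quadratic coefficient at a jump from weight 1 to weight 0; hence `A` cannot jump (`classification`).

Conversely, the relations of `V_{A,β}` hold because it is the submodule of `V_{0,β}` generated by
the elements `(∂ + β)^{a_m} v_m`. The constancy of `A` for `d ≠ 0` is also necessary: a nonzero
constant `Y_i` cannot connect two different weights of `L_0`. -/

theorem bivariate_eq_zero {Q : ℂ[X][X]} (h : ∀ x s, Q.evalEval s x = 0) : Q = 0 := by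
  refine Polynomial.ext fun n => Polynomial.funext fun s => ?_
  have h1 : Q.map (evalRingHom s) = 0 := Polynomial.funext fun x => by
    rw [eval_zero, ← h x s, ← eval₂_evalRingHom, eval₂_eq_eval_map]
  have h2 := congrArg (fun p => coeff p n) h1
  simpa using h2

theorem eval_map_evalRingHom_eq_evalEval (Q : ℂ[X][X]) (s x : ℂ) :
    (Q.map (evalRingHom s)).eval x = Q.evalEval s x := by
  rw [← eval₂_evalRingHom, eval₂_eq_eval_map]

theorem bivariate_ne_zero {Q : ℂ[X][X]} (h : Q ≠ 0) : ∃ x s, Q.evalEval s x ≠ 0 := by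
  by_contra! h'
  exact h (bivariate_eq_zero h')

theorem bivariate_mul_eq_zero {P Q : ℂ[X][X]}
    (h : ∀ x s, P.evalEval s x * Q.evalEval s x = 0) : P = 0 ∨ Q = 0 := by
  rw [← mul_eq_zero]
  exact bivariate_eq_zero fun x s => by rw [evalEval_mul, h]

/-- The substitution `x ↦ x + s` is an automorphism of the domain `ℂ[x, s]`. Products of this shape
are compositions of two operators restricted to the diagonal `λ = μ`, where the right side of a
commutator relation with factor `s - t` disappears. -/
theorem bivariate_shift_mul_eq_zero {P Q : ℂ[X][X]}
    (h : ∀ x s, P.evalEval s (x + s) * Q.evalEval s x = 0) : P = 0 ∨ Q = 0 := by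
  have hP : ∀ x s, (P.comp (X + C X)).evalEval s x = P.evalEval s (x + s) := by
    intro x s
    rw [← eval_map_evalRingHom_eq_evalEval, Polynomial.map_comp, eval_comp,
      ← eval_map_evalRingHom_eq_evalEval]
    simp
  rcases bivariate_mul_eq_zero (P := P.comp (X + C X)) (Q := Q)
    (fun x s => by rw [hP, h]) with h1 | h1
  · left
    refine bivariate_eq_zero fun x s => ?_
    have := hP (x - s) s
    rw [h1] at this
    simpa using this.symm
  · exact Or.inr h1

theorem bivariate_mul_linear_eq_zero {Q : ℂ[X][X]} (p q r : ℂ) (hpqr : p ≠ 0 ∨ q ≠ 0 ∨ r ≠ 0)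
    (h : ∀ x s, (p * x + q * s + r) * Q.evalEval s x = 0) : Q = 0 := by
  let P : ℂ[X][X] := C (C p) * X + C (C q * X + C r)
  have hP : ∀ x s, P.evalEval s x = p * x + q * s + r := by
    intro x s
    simp [P, evalEval]
    ring
  rcases bivariate_mul_eq_zero (P := P) (Q := Q) (fun x s => by rw [hP, h]) with h1 | h1
  · exfalso
    have h0 : ∀ x s, p * x + q * s + r = 0 := fun x s => by rw [← hP, h1, evalEval_zero]
    have h00 := h0 0 0
    have h10 := h0 1 0
    have h01 := h0 0 1
    simp only [mul_zero, mul_one, zero_add, add_zero] at h00 h10 h01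
    subst h00
    simp_all
  · exact h1

/-! ### Bounds on the degree in `∂` -/

theorem natDegree_map_evalRingHom_le (Q : ℂ[X][X]) (s : ℂ) :
    (Q.map (evalRingHom s)).natDegree ≤ Q.natDegree := natDegree_map_le

theorem evalEval_eq_of_natDegree_eq_zero {Q : ℂ[X][X]} (h : Q.natDegree = 0) (x y s : ℂ) :
    Q.evalEval s x = Q.evalEval s y := by
  rw [eq_C_of_natDegree_eq_zero h, evalEval_C, evalEval_C]

theorem exists_eval_ne_zero_and_ne {a : ℂ[X]} (ha : a ≠ 0) :
    ∃ s t, s ≠ t ∧ a.eval s ≠ 0 ∧ a.eval t ≠ 0 := by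
  have h1 : ∃ s, a.eval s ≠ 0 := by
    by_contra! h
    exact ha (Polynomial.funext fun s => by simp [h])
  obtain ⟨s, hs⟩ := h1
  have h2 : ∃ t, (a * (X - C s)).eval t ≠ 0 := by
    by_contra! h
    exact mul_ne_zero ha (X_sub_C_ne_zero s) (Polynomial.funext fun s => by simp [h])
  obtain ⟨t, ht⟩ := h2
  simp only [eval_mul, eval_sub, eval_X, eval_C, ne_eq, mul_eq_zero, not_or, sub_eq_zero] at ht
  exact ⟨s, t, fun h => ht.2 h.symm, hs, ht.1⟩

theorem natDegree_taylor_sub_le {p : ℂ[X]} {k : ℕ} (hp : p.natDegree ≤ k + 1) (s : ℂ) :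
    (taylor s p - p).natDegree ≤ k ∧ (taylor s p - p).coeff k = (k + 1) * s * p.coeff (k + 1) := by
  have h0 : ∀ j, j > k + 1 → p.coeff j = 0 := fun j hj =>
    coeff_eq_zero_of_natDegree_lt (by omega)
  have hc : ∀ j, (taylor s p).coeff j = ((hasseDeriv j p).coeff 0) + s * (hasseDeriv j p).coeff 1 +
      ∑ i ∈ Finset.range k, (hasseDeriv j p).coeff (i + 2) * s ^ (i + 2) := by
    intro j
    rw [taylor_coeff, eval_eq_sum_range' (n := k + 2)
      (lt_of_le_of_lt (natDegree_hasseDeriv_le _ _) (by omega)), Finset.sum_range_succ',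
      Finset.sum_range_succ']
    ring
  have h1 : (taylor s p - p).natDegree ≤ k + 1 := by
    refine (natDegree_sub_le _ _).trans ?_
    rw [natDegree_taylor]
    simpa using hp
  refine ⟨?_, ?_⟩
  · refine natDegree_le_pred h1 ?_
    rw [coeff_sub, hc]
    simp only [hasseDeriv_coeff]
    rw [Finset.sum_eq_zero fun i _ => by rw [h0 _ (by omega)]; simp, h0 (1 + (k + 1)) (by omega)]
    simp
  · rw [coeff_sub, hc]
    simp only [hasseDeriv_coeff]
    rw [Finset.sum_eq_zero fun i _ => by rw [h0 _ (by omega)]; simp]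
    rw [add_comm 1 k, Nat.choose_succ_self_right]
    simp
    ring

/-- Let `n ≥ 1` be the degree of `P` in `∂` and `c(λ)` its leading coefficient. On the left the
terms of degree `2n` cancel and the coefficient of degree `2n - 1` is `n (s - t) c(s) c(t)`, which
is nonzero for suitable `s ≠ t`. The bound serves three times: `R = P` for `L_0`, `R = 0` for `M_0`,
and `R` of degree zero for `Y_0`. -/
theorem natDegree_le_of_commutator {P R : ℂ[X][X]}
    (h : ∀ x s t, P.evalEval t (x + s) * P.evalEval s x - P.evalEval s (x + t) * P.evalEval t x =
      (s - t) * R.evalEval (s + t) x) : 2 * P.natDegree ≤ R.natDegree + 1 := by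
  rcases Nat.eq_zero_or_eq_succ_pred P.natDegree with hn | hn
  · omega
  set k := P.natDegree.pred
  have hP : P ≠ 0 := by
    rintro rfl
    simp at hn
  obtain ⟨s, t, hst, hs, ht⟩ := exists_eval_ne_zero_and_ne (leadingCoeff_ne_zero.2 hP)
  by_contra hlt
  have hp : ∀ u, (P.map (evalRingHom u)).natDegree ≤ k + 1 := fun u =>
    (natDegree_map_evalRingHom_le P u).trans hn.le
  have hlead : ∀ u, (P.map (evalRingHom u)).coeff (k + 1) = P.leadingCoeff.eval u := by
    intro u
    rw [coeff_map, leadingCoeff, hn]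
    rfl
  -- Subtracting the product `P_t P_s` from both compositions leaves finite differences, each of
  -- degree one less.
  have key : (taylor s (P.map (evalRingHom t)) - P.map (evalRingHom t)) * P.map (evalRingHom s) -
      (taylor t (P.map (evalRingHom s)) - P.map (evalRingHom s)) * P.map (evalRingHom t) =
      C (s - t) * R.map (evalRingHom (s + t)) := by
    refine Polynomial.funext fun x => ?_
    simp only [eval_sub, eval_mul, taylor_eval, eval_map_evalRingHom_eq_evalEval, eval_C, ← h]
    ring
  have hcoef := congrArg (fun p => coeff p (k + (k + 1))) key
  simp only [coeff_sub, coeff_C_mul] at hcoef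
  rw [coeff_mul_add_eq_of_natDegree_le (natDegree_taylor_sub_le (hp t) s).1 (hp s),
    coeff_mul_add_eq_of_natDegree_le (natDegree_taylor_sub_le (hp s) t).1 (hp t),
    (natDegree_taylor_sub_le (hp t) s).2, (natDegree_taylor_sub_le (hp s) t).2,
    coeff_eq_zero_of_natDegree_lt (lt_of_le_of_lt (natDegree_map_evalRingHom_le R _) (by omega)),
    mul_zero, hlead, hlead] at hcoef
  have : ((k : ℂ) + 1) * (s - t) * (P.leadingCoeff.eval s * P.leadingCoeff.eval t) = 0 := by
    linear_combination hcoef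
  have hk : (k : ℂ) + 1 ≠ 0 := by exact_mod_cast Nat.succ_ne_zero k
  simp [hk, hs, ht, sub_eq_zero, hst] at this

/-! ### Rank one modules over the Virasoro conformal algebra -/

/-- The product relation excludes roots, so `a` is constant over the algebraically closed field. -/
theorem eq_one_of_eval_add {a : ℂ[X]} (h0 : a.eval 0 = 1)
    (h : ∀ s, s ≠ 0 → a.eval s * a.eval (-s) = 1) : a = 1 := by
  have hdeg : a.degree = 0 := by
    by_contra hd
    obtain ⟨z, hz⟩ := IsAlgClosed.exists_root a hd
    rw [IsRoot.def] at hz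
    by_cases hz0 : z = 0
    · rw [hz0, h0] at hz
      exact one_ne_zero hz
    · have := h z hz0
      rw [hz, zero_mul] at this
      exact zero_ne_one this
  rw [eq_C_of_degree_eq_zero hdeg] at h0 ⊢
  rw [eval_C] at h0
  rw [h0, C_1]

/-- Differentiating in `t` at `t = 0` gives `s q'(s) = q(s) - q(0)`, which kills every coefficient
of degree at least two. -/
theorem eval_eq_linear {q : ℂ[X]}
    (h : ∀ s t, s * q.eval s - t * q.eval t = (s - t) * q.eval (s + t)) :
    ∃ α β, ∀ s, q.eval s = α * s + β := by
  have hd : ∀ s, s * (derivative q).eval s = q.eval s - q.eval 0 := by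
    intro s
    have h1 : C s * C (q.eval s) - X * q = (C s - X) * q.comp (C s + X) :=
      Polynomial.funext fun t => by simp [eval_comp, h]
    have h2 := congrArg (fun p => (derivative p).eval 0) h1
    simp [derivative_comp] at h2
    linear_combination -h2
  have hd2 : X * derivative q = q - C (q.eval 0) := Polynomial.funext fun s => by simp [hd]
  have hc : ∀ n, q.coeff (n + 2) = 0 := by
    intro n
    have h3 := congrArg (fun p => coeff p (n + 2)) hd2
    simp only [coeff_X_mul, coeff_derivative, coeff_sub, coeff_C_succ] at h3
    have h4 : ((n : ℂ) + 1) * q.coeff (n + 2) = 0 := by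
      push_cast at h3
      linear_combination h3
    have hk : (n : ℂ) + 1 ≠ 0 := by exact_mod_cast Nat.succ_ne_zero n
    simpa [hk] using h4
  have hdeg : q.natDegree ≤ 1 := by
    rw [natDegree_le_iff_coeff_eq_zero]
    intro N hN
    obtain ⟨n, rfl⟩ : ∃ n, N = n + 2 := ⟨N - 2, by omega⟩
    exact hc n
  refine ⟨q.coeff 1, q.coeff 0, fun s => ?_⟩
  rw [eval_eq_sum_range' (n := 2) (by omega)]
  simp [Finset.sum_range_succ]
  ring

/-- By the degree bound `P = a(λ) ∂ + b(λ)`. The relation at `t = 0` gives `a(0) = 1`, the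
coefficient of `∂` at `t = -s` gives `a(s) a(-s) = 1`, hence `a = 1`; what remains is the functional
equation of `eval_eq_linear` for `b`. -/
theorem virasoro_rank_one {P : ℂ[X][X]} (hP : P ≠ 0)
    (h : ∀ x s t, P.evalEval t (x + s) * P.evalEval s x - P.evalEval s (x + t) * P.evalEval t x =
      (s - t) * P.evalEval (s + t) x) :
    ∃ α β : ℂ, ∀ x s, P.evalEval s x = x + α * s + β := by
  have hdeg := natDegree_le_of_commutator h
  have hab : ∀ x s, P.evalEval s x = (P.coeff 1).eval s * x + (P.coeff 0).eval s := by
    intro x s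
    rw [← eval_map_evalRingHom_eq_evalEval, eval_eq_sum_range' (n := 2)
      (lt_of_le_of_lt (natDegree_map_evalRingHom_le P s) (by omega))]
    simp [Finset.sum_range_succ]
    ring
  have h0 : (P.coeff 1).eval 0 = 1 := by
    have h1 : ∀ x s, ((P.coeff 1).eval 0 - 1) * s * P.evalEval s x = 0 := by
      intro x s
      have := h x s 0
      simp only [add_zero, sub_zero] at this
      rw [hab (x + s) 0, hab x 0] at this
      linear_combination this
    by_contra hne
    exact hP (bivariate_mul_linear_eq_zero 0 ((P.coeff 1).eval 0 - 1) 0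
      (Or.inr (Or.inl (sub_ne_zero.2 hne))) fun x s => by linear_combination h1 x s)
  have ha : P.coeff 1 = 1 := by
    refine eq_one_of_eval_add h0 fun s hs => ?_
    have e1 := h 1 s (-s)
    have e0 := h 0 s (-s)
    simp only [hab, add_neg_cancel, h0] at e1 e0
    have : 2 * s * ((P.coeff 1).eval s * (P.coeff 1).eval (-s) - 1) = 0 := by
      linear_combination e1 - e0
    simpa [hs, sub_eq_zero] using this
  obtain ⟨α, β, hb⟩ := eval_eq_linear (q := P.coeff 0) (by
    intro s t
    have e0 := h 0 s t
    simp only [hab, ha, eval_one] at e0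
    linear_combination e0)
  refine ⟨α, β, fun x s => ?_⟩
  rw [hab, ha, hb, eval_one]
  ring

/-! ### Intertwiners between rank one modules -/

/-- After translation by `β`, `w` is an eigenvector of the Euler operator `x d/dx`, whose
eigenvalues on polynomials are the natural numbers and whose eigenvectors are the monomials. -/
theorem exists_monomial_of_euler {w : ℂ[X]} (hw : w ≠ 0) (β c : ℂ)
    (h : ∀ x, (x + β) * (derivative w).eval x = c * w.eval x) :
    ∃ (n : ℕ) (p : ℂ), c = n ∧ p ≠ 0 ∧ ∀ x, w.eval x = p * (x + β) ^ n := by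
  set u := taylor (-β) w with hu
  have hwu : ∀ x, w.eval x = u.eval (x + β) := fun x => by rw [hu, taylor_eval]; simp
  have hu0 : u ≠ 0 := by
    rw [hu, ne_eq, taylor_eq_zero]
    exact hw
  have hder : X * derivative u = C c * u := by
    refine Polynomial.funext fun x => ?_
    have := h (x + -β)
    simp only [hu, taylor_apply, derivative_comp, eval_mul, eval_X, eval_comp, eval_C,
      eval_add, derivative_add, derivative_X, derivative_C, eval_one, eval_zero]
    rw [← this]
    ring
  have hcoef : ∀ n : ℕ, ((n : ℂ) - c) * u.coeff n = 0 := by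
    intro n
    have h3 := congrArg (fun p => coeff p n) hder
    cases n with
    | zero => simp at h3; simp; exact h3
    | succ n =>
      simp only [coeff_X_mul, coeff_derivative, coeff_C_mul] at h3
      push_cast
      linear_combination h3
  obtain ⟨n, hn⟩ : ∃ n, u.coeff n ≠ 0 := by
    by_contra! h'
    exact hu0 (Polynomial.ext fun n => by simp [h'])
  have hcn : c = n := by
    have := hcoef n
    simp only [mul_eq_zero, hn, or_false, sub_eq_zero] at this
    exact this.symm
  refine ⟨n, u.coeff n, hcn, hn, fun x => ?_⟩
  have : u = monomial n (u.coeff n) := by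
    ext m
    rw [coeff_monomial]
    split_ifs with hm
    · rw [hm]
    · have h4 := hcoef m
      rw [hcn, mul_eq_zero, sub_eq_zero] at h4
      rcases h4 with h4 | h4
      · exact absurd (Nat.cast_injective h4).symm hm
      · exact h4
  rw [hwu, this, eval_monomial]
  simp

/-- Coefficients of operators between the rank one modules with `L_λ v = (∂ + αλ + β) v` and
`L_λ v' = (∂ + α'λ + β) v'` that intertwine like `L` itself. -/
theorem intertwiner_at_zero {Q : ℂ[X][X]} (hQ : Q ≠ 0) {α α' β : ℂ}
    (h : ∀ x s t, Q.evalEval t (x + s) * (x + α' * s + β) -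
      (x + t + α * s + β) * Q.evalEval t x = (s - t) * Q.evalEval (s + t) x) :
    ∃ (n : ℕ) (p : ℂ), 1 + α - α' = n ∧ p ≠ 0 ∧ ∀ x s,
      s * Q.evalEval s x = p * ((x + s + β) ^ n * (x + α' * s + β) -
        (x + β) ^ n * (x + α * s + β)) := by
  set w : ℂ[X] := Q.map (evalRingHom 0) with hw
  have hw0 : ∀ x, Q.evalEval 0 x = w.eval x := fun x =>
    (eval_map_evalRingHom_eq_evalEval Q 0 x).symm
  -- At `t = 0` the relation expresses all of `Q` through its value `w` at `λ = 0`.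
  have h1 : ∀ x s, s * Q.evalEval s x = w.eval (x + s) * (x + α' * s + β) -
      w.eval x * (x + α * s + β) := by
    intro x s
    have := h x s 0
    simp only [add_zero, sub_zero, hw0] at this
    linear_combination -this
  have hwne : w ≠ 0 := by
    intro h0
    refine hQ (bivariate_mul_linear_eq_zero 0 1 0 (by simp) fun x s => ?_)
    have := h1 x s
    simp only [h0, eval_zero] at this
    linear_combination this
  obtain ⟨n, p, hn, hp, hwn⟩ := exists_monomial_of_euler hwne β (1 + α - α') (by
    intro x
    -- The derivative in `s` at `s = 0` is the Euler equation for `w`.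
    have e1 : X * Q.eval (C x) = w.comp (C x + X) * (C x + C α' * X + C β) -
        C (w.eval x) * (C x + C α * X + C β) :=
      Polynomial.funext fun s => by
        have := h1 x s
        simp only [evalEval] at this
        simp [eval_comp, this]
    have e2 := congrArg (fun p => (derivative p).eval 0) e1
    simp [derivative_comp] at e2
    have e3 : eval 0 (eval (C x) Q) = eval x w := hw0 x
    rw [e3] at e2
    linear_combination -e2)
  refine ⟨n, p, hn, hp, fun x s => ?_⟩
  rw [h1, hwn, hwn]
  ring

theorem evalEval_eq_of_mul_eq {Q : ℂ[X][X]} {R : ℂ[X][X]}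
    (h : ∀ x s, s * Q.evalEval s x = s * R.evalEval s x) : Q = R := by
  rw [← sub_eq_zero]
  refine bivariate_mul_linear_eq_zero 0 1 0 (by simp) fun x s => ?_
  rw [evalEval_sub]
  linear_combination h x s
end

noncomputable section
/-! ### Coefficients of the action of the loop Virasoro conformal algebra -/

/-- `P i m` are the coefficients of operators `L_i _λ v_m = P i m v_{i+m}` that satisfy the
relations of the loop Virasoro conformal algebra. -/
def IsLoopVirasoro (P : ℤ → ℤ → ℂ[X][X]) : Prop :=
  ∀ i j m x s t, (P j m).evalEval t (x + s) * (P i (j + m)).evalEval s x -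
    (P i m).evalEval s (x + t) * (P j (i + m)).evalEval t x =
      (s - t) * (P (i + j) m).evalEval (s + t) x

namespace IsLoopVirasoro

variable {P : ℤ → ℤ → ℂ[X][X]}

theorem eq_zero_or (hP : IsLoopVirasoro P) (m : ℤ) :
    P 0 m = 0 ∨ ∃ α β : ℂ, ∀ x s, (P 0 m).evalEval s x = x + α * s + β := by
  by_cases h : P 0 m = 0
  · exact Or.inl h
  · refine Or.inr (virasoro_rank_one h fun x s t => ?_)
    simpa using hP 0 0 m x s t

/-- This is the commutator with `L_0` at `λ = 0`. Where `L_j` acts nontrivially the first factor has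
to vanish identically, which compares the actions of `L_0` on source and target. -/
theorem mul_eq_zero_aux (hP : IsLoopVirasoro P) (j m : ℤ) (x t : ℂ) :
    ((P 0 (j + m)).evalEval 0 x - (P 0 m).evalEval 0 (x + t) + t) * (P j m).evalEval t x = 0 := by
  have := hP 0 j m x 0 t
  simp only [add_zero, zero_add, zero_sub] at this
  linear_combination this

theorem zero_ne_zero_of_ne_zero (hP : IsLoopVirasoro P) {j m : ℤ} (h : P j m ≠ 0) :
    P 0 m ≠ 0 ∧ P 0 (j + m) ≠ 0 := by
  have h1 := hP.mul_eq_zero_aux j m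
  rcases hP.eq_zero_or m with h0 | ⟨α, β, h0⟩ <;>
    rcases hP.eq_zero_or (j + m) with h0' | ⟨α', β', h0'⟩
  · exact absurd (bivariate_mul_linear_eq_zero 0 1 0 (by simp) fun x s => by
      have := h1 x s
      simp only [h0, h0', evalEval_zero] at this
      linear_combination this) h
  · exact absurd (bivariate_mul_linear_eq_zero 1 1 β' (by simp) fun x s => by
      have := h1 x s
      simp only [h0, h0', evalEval_zero] at this
      linear_combination this) h
  · exact absurd (bivariate_mul_linear_eq_zero (-1) 0 (-β) (by simp) fun x s => by
      have := h1 x s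
      simp only [h0, h0', evalEval_zero] at this
      linear_combination this) h
  · refine ⟨fun h2 => ?_, fun h2 => ?_⟩
    · have a0 := h0 0 0
      have a1 := h0 1 0
      rw [h2, evalEval_zero] at a0 a1
      exact one_ne_zero (α := ℂ) (by linear_combination a0 - a1)
    · have a0 := h0' 0 0
      have a1 := h0' 1 0
      rw [h2, evalEval_zero] at a0 a1
      exact one_ne_zero (α := ℂ) (by linear_combination a0 - a1)

/-- If `L_j` kills `v_m`, only one of the two compositions in the commutator of `L_{-j}` and `L_j`
survives. It vanishes for `s = t`, so one of its factors is zero, the composition vanishes for all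
`s, t`, and `L_0` kills `v_m` too. -/
theorem ne_zero_of_zero_ne_zero (hP : IsLoopVirasoro P) {m : ℤ} (h : P 0 m ≠ 0) (j : ℤ) :
    P j m ≠ 0 := by
  intro hj
  have h1 : ∀ x s t, (P (-j) m).evalEval s (x + t) * (P j (-j + m)).evalEval t x =
      -((s - t) * (P 0 m).evalEval (s + t) x) := by
    intro x s t
    have := hP (-j) j m x s t
    rw [hj, evalEval_zero, neg_add_cancel] at this
    linear_combination -this
  refine h (bivariate_mul_linear_eq_zero 0 1 0 (by simp) fun x s => ?_)
  have h2 := h1 x s 0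
  rcases bivariate_shift_mul_eq_zero (P := P (-j) m) (Q := P j (-j + m))
    (fun x s => by rw [h1]; simp) with h3 | h3 <;>
  · rw [h3, evalEval_zero] at h2
    simpa using h2

theorem exists_weights (hP : IsLoopVirasoro P) (hne : ∃ j m, P j m ≠ 0) :
    (∀ j m, P j m ≠ 0) ∧ ∃ (β : ℂ) (α : ℤ → ℂ), ∀ m x s,
      (P 0 m).evalEval s x = x + α m * s + β := by
  obtain ⟨j0, m0, h0⟩ := hne
  have h1 := (hP.zero_ne_zero_of_ne_zero h0).1
  have h2 : ∀ m, P 0 m ≠ 0 := by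
    intro m
    have := (hP.zero_ne_zero_of_ne_zero (hP.ne_zero_of_zero_ne_zero h1 (m - m0))).2
    rwa [sub_add_cancel] at this
  have h3 : ∀ j m, P j m ≠ 0 := fun j m => hP.ne_zero_of_zero_ne_zero (h2 m) j
  refine ⟨h3, ?_⟩
  have h4 : ∀ m, ∃ α β : ℂ, ∀ x s, (P 0 m).evalEval s x = x + α * s + β := fun m =>
    (hP.eq_zero_or m).resolve_left (h2 m)
  choose α β hαβ using h4
  refine ⟨β m0, α, fun m x s => ?_⟩
  have h5 : β m = β m0 := by
    by_contra hne
    refine h3 (m - m0) m0 (bivariate_mul_linear_eq_zero 0 0 (β m - β m0)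
      (Or.inr (Or.inr (sub_ne_zero.2 hne))) fun x s => ?_)
    have := hP.mul_eq_zero_aux (m - m0) m0 x s
    rw [sub_add_cancel, hαβ, hαβ] at this
    linear_combination this
  rw [hαβ, h5]

theorem intertwiner (hP : IsLoopVirasoro P) {β : ℂ} {α : ℤ → ℂ}
    (h0 : ∀ m x s, (P 0 m).evalEval s x = x + α m * s + β) (j m : ℤ) (x s t : ℂ) :
    (P j m).evalEval t (x + s) * (x + α (j + m) * s + β) -
      (x + t + α m * s + β) * (P j m).evalEval t x = (s - t) * (P j m).evalEval (s + t) x := by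
  have := hP 0 j m x s t
  rw [h0, h0, zero_add, zero_add] at this
  exact this

/-- The exponents `n = 1 + α m - α (j + m)` for `L_j` and `n'` for the return by `L_{-j}` are
natural numbers with sum 2. For `n = 1` the weights agree; for `n = 2` the intertwining relation
forces the weights 1 and 0; for `n = 0` the weights follow from the case `n' = 2` of the return map.
-/
theorem coefficient_cases (hP : IsLoopVirasoro P) (hne : ∀ j m, P j m ≠ 0) {β : ℂ} {α : ℤ → ℂ}
    (h0 : ∀ m x s, (P 0 m).evalEval s x = x + α m * s + β) (j m : ℤ) :
    ∃ c : ℂ, c ≠ 0 ∧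
      ((α (j + m) = α m ∧ ∀ x s, (P j m).evalEval s x = c * (x + α m * s + β)) ∨
      (α m = 0 ∧ α (j + m) = 1 ∧ ∀ x s, (P j m).evalEval s x = c) ∨
      (α m = 1 ∧ α (j + m) = 0 ∧
        ∀ x s, (P j m).evalEval s x = c * ((x + β) * (x + β + s)))) := by
  have quadratic : ∀ j m, 1 + α m - α (j + m) = 2 → ∃ c : ℂ, c ≠ 0 ∧ α m = 1 ∧ α (j + m) = 0 ∧
      ∀ x s, (P j m).evalEval s x = c * ((x + β) * (x + β + s)) := by
    intro j m h2
    obtain ⟨n, p, hn, hp, h⟩ := intertwiner_at_zero (hne j m) (hP.intertwiner h0 j m)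
    have hn2 : n = 2 := by
      rw [h2] at hn
      exact_mod_cast hn.symm
    have hα' : α (j + m) = α m - 1 := by linear_combination -h2
    subst hn2
    let R : ℂ[X][X] := C (C p) * ((X + C (C β)) ^ 2 + C (C (2 * α m - 1)) * (X + C (C β)) * C X +
      C (C (α m - 1)) * C X ^ 2)
    have hR : ∀ x s, R.evalEval s x =
        p * ((x + β) ^ 2 + (2 * α m - 1) * (x + β) * s + (α m - 1) * s ^ 2) := by
      intro x s
      simp [R, evalEval]
    have hQ : P j m = R := evalEval_eq_of_mul_eq fun x s => by
      rw [h, hR, hα']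
      ring
    have h1 : α m = 1 := by
      -- At this point the relation reduces to `8 p (α m - 1)² = 0`.
      have e := hP.intertwiner h0 j m (-β) 2 1
      rw [hQ] at e
      simp only [hR, hα'] at e
      have : p * ((α m - 1) * (α m - 1)) = 0 := by linear_combination e / 8
      simpa [hp, sub_eq_zero] using this
    refine ⟨p, hp, h1, by rw [hα', h1, sub_self], fun x s => ?_⟩
    rw [hQ, hR, h1]
    ring
  obtain ⟨n, p, hn, hp, h⟩ := intertwiner_at_zero (hne j m) (hP.intertwiner h0 j m)
  obtain ⟨n', p', hn', -, -⟩ := intertwiner_at_zero (hne (-j) (j + m))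
    (hP.intertwiner h0 (-j) (j + m))
  rw [neg_add_cancel_left] at hn'
  have hsum : n + n' = 2 := by
    have : (n : ℂ) + n' = 2 := by rw [← hn, ← hn']; ring
    exact_mod_cast this
  obtain rfl | rfl | rfl : n = 0 ∨ n = 1 ∨ n = 2 := by omega
  · obtain rfl : n' = 2 := by omega
    obtain ⟨-, -, h1, h2, -⟩ := quadratic (-j) (j + m) (by
      rw [neg_add_cancel_left, hn', Nat.cast_ofNat])
    rw [neg_add_cancel_left] at h2
    have hQ : P j m = C (C p) := evalEval_eq_of_mul_eq fun x s => by
      rw [h, h1, h2]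
      simp
      ring
    exact ⟨p, hp, Or.inr (Or.inl ⟨h2, h1, fun x s => by rw [hQ]; simp⟩)⟩
  · have hα : α (j + m) = α m := by
      push_cast at hn
      linear_combination -hn
    have hR : ∀ x s, (C (C p) * (X + C (C (α m)) * C X + C (C β)) : ℂ[X][X]).evalEval s x =
        p * (x + α m * s + β) := by
      intro x s
      simp [evalEval]
    have hQ : P j m = C (C p) * (X + C (C (α m)) * C X + C (C β)) :=
      evalEval_eq_of_mul_eq fun x s => by
        rw [h, hR, hα]
        ring
    exact ⟨p, hp, Or.inl ⟨hα, fun x s => by rw [hQ, hR]⟩⟩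
  · obtain ⟨c, hc, h1, h2, h3⟩ := quadratic j m (by rw [hn, Nat.cast_ofNat])
    exact ⟨c, hc, Or.inr (Or.inr ⟨h1, h2, h3⟩)⟩

/-- Scalar multiples of a system of coefficients that satisfies the loop Virasoro relations differ
from it by a change of the basis. -/
theorem exists_rescaling (hP : IsLoopVirasoro P) (hne : ∀ j m, P j m ≠ 0)
    {ψ : ℂ → ℤ → ℤ → ℂ[X]}
    (hψ : ∀ i j m x s t, (ψ t j m).eval (x + s) * (ψ s i (j + m)).eval x -
      (ψ s i m).eval (x + t) * (ψ t j (i + m)).eval x = (s - t) * (ψ (s + t) (i + j) m).eval x)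
    (hc : ∀ j m, ∃ c : ℂ, c ≠ 0 ∧ ∀ x s, (P j m).evalEval s x = c * (ψ s j m).eval x) :
    ∃ g : ℤ → ℂ, (∀ m, g m ≠ 0) ∧
      ∀ j m x s, g m * (P j m).evalEval s x = g (j + m) * (ψ s j m).eval x := by
  choose c hc0 hc using hc
  -- On the diagonal `s = t` both commutators vanish; if the scalars differed, the composition
  -- itself would vanish there, against `hne`.
  have h1 : ∀ i j m, c j m * c i (j + m) = c i m * c j (i + m) := by
    intro i j m
    by_contra hne'
    have h2 : ∀ x t, (P j m).evalEval t (x + t) * (P i (j + m)).evalEval t x = 0 := by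
      intro x t
      have e1 := hP i j m x t t
      have e2 := hψ i j m x t t
      rw [sub_self, zero_mul] at e1 e2
      simp only [hc] at e1 ⊢
      have e3 : (c j m * c i (j + m) - c i m * c j (i + m)) *
          ((ψ t j m).eval (x + t) * (ψ t i (j + m)).eval x) = 0 := by
        linear_combination e1 - c i m * c j (i + m) * e2
      rw [mul_eq_zero, sub_eq_zero] at e3
      linear_combination c j m * c i (j + m) * e3.resolve_left hne'
    rcases bivariate_shift_mul_eq_zero h2 with h3 | h3
    · exact hne _ _ h3
    · exact hne _ _ h3
  have h2 : ∀ i j m, c j m * c i (j + m) = c (i + j) m := by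
    intro i j m
    obtain ⟨x, u, hx⟩ := bivariate_ne_zero (hne (i + j) m)
    -- The two parameters have sum `u`, where the coefficient is nonzero, and difference 1.
    have e1 := hP i j m x (u / 2 + 1 / 2) (u / 2 - 1 / 2)
    have e2 := hψ i j m x (u / 2 + 1 / 2) (u / 2 - 1 / 2)
    have hu : u / 2 + 1 / 2 + (u / 2 - 1 / 2) = u := by ring
    have hu' : u / 2 + 1 / 2 - (u / 2 - 1 / 2) = 1 := by ring
    rw [hu, hu', one_mul] at e1 e2
    rw [hc] at hx
    simp only [hc] at e1
    have hx' : (ψ u (i + j) m).eval x ≠ 0 := right_ne_zero_of_mul hx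
    refine mul_right_cancel₀ hx' ?_
    linear_combination e1 - c j m * c i (j + m) * e2 -
      ((ψ (u / 2 + 1 / 2) i m).eval (x + (u / 2 - 1 / 2)) *
        (ψ (u / 2 - 1 / 2) j (i + m)).eval x) * h1 i j m
  -- The cocycle identity `h2` based at degree 0 exhibits `c` as a coboundary.
  refine ⟨fun m => c m 0, fun m => hc0 m 0, fun j m x s => ?_⟩
  have := h2 j m 0
  rw [add_zero] at this
  rw [hc]
  linear_combination (ψ s j m).eval x * this

end IsLoopVirasoro

/-- Conceptually, `coeffA` describes the action of `V_{0,β}` on the vectors `(∂ + β)^{a_m} v_m`. The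
verification runs through the values of `A` at the four degrees involved. -/
theorem coeffA_relation (A : ℤ → Fin 2) (β : ℂ) (i j m : ℤ) (x s t : ℂ) :
    (coeffA A β t j m).eval (x + s) * (coeffA A β s i (j + m)).eval x -
      (coeffA A β s i m).eval (x + t) * (coeffA A β t j (i + m)).eval x =
      (s - t) * (coeffA A β (s + t) (i + j) m).eval x := by
  have h01 : ∀ k : Fin 2, k = 0 ∨ k = 1 := by decide
  unfold coeffA
  rw [add_left_comm j i m, ← add_assoc i j m]
  rcases h01 (A m) with h1 | h1 <;> rcases h01 (A (i + m)) with h2 | h2 <;>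
    rcases h01 (A (j + m)) with h3 | h3 <;> rcases h01 (A (i + j + m)) with h4 | h4 <;>
    simp only [h1, h2, h3, h4, eval_add, eval_mul, eval_X, eval_C, eval_one] <;> ring

/-- The coefficients of a nontrivial system are, up to a change of the basis, those of `V_{α,β}`
or of `V_{A,β}` with nonconstant `A`. -/
theorem IsLoopVirasoro.normal_form {P : ℤ → ℤ → ℂ[X][X]} (hP : IsLoopVirasoro P)
    (hne : ∃ j m, P j m ≠ 0) : ∃ (β : ℂ) (g : ℤ → ℂ), (∀ m, g m ≠ 0) ∧
      ((∃ α : ℂ, ∀ j m x s,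
          g m * (P j m).evalEval s x = g (j + m) * (X + C (α * s + β) : ℂ[X]).eval x) ∨
        ∃ A : ℤ → Fin 2, (∃ j m, A m = 1 ∧ A (j + m) = 0) ∧ ∀ j m x s,
          g m * (P j m).evalEval s x = g (j + m) * (coeffA A β s j m).eval x) := by
  obtain ⟨hne, β, α, h0⟩ := hP.exists_weights hne
  have hcases := hP.coefficient_cases hne h0
  refine ⟨β, ?_⟩
  by_cases hconst : ∀ m, α m = α 0
  · obtain ⟨g, hg, h⟩ := hP.exists_rescaling hne (ψ := fun t _ _ => X + C (α 0 * t + β)) (by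
      intro i j m x s t
      simp only [eval_add, eval_X, eval_C]
      ring) (by
      intro j m
      obtain ⟨c, hc, ⟨-, h⟩ | ⟨h1, h2, -⟩ | ⟨h1, h2, -⟩⟩ := hcases j m
      · refine ⟨c, hc, fun x s => ?_⟩
        rw [h, hconst m]
        simp only [eval_add, eval_X, eval_C]
        ring
      · rw [hconst] at h1 h2
        simp [h1] at h2
      · rw [hconst] at h1 h2
        simp [h1] at h2)
    exact ⟨g, hg, Or.inl ⟨α 0, h⟩⟩
  · push Not at hconst
    obtain ⟨m0, hm0⟩ := hconst
    -- A single weight different from `α 0` is reached from degree 0 by a jump, and jumps occur only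
    -- between 0 and 1.
    have h00 : α 0 = 0 ∨ α 0 = 1 := by
      obtain ⟨c, hc, ⟨h, -⟩ | ⟨h1, h2, -⟩ | ⟨h1, h2, -⟩⟩ := hcases m0 0
      · rw [add_zero] at h
        exact absurd h hm0
      · exact Or.inl h1
      · exact Or.inr h1
    have h01 : ∀ m, α m = 0 ∨ α m = 1 := by
      intro m
      obtain ⟨c, hc, ⟨h, -⟩ | ⟨h1, h2, -⟩ | ⟨h1, h2, -⟩⟩ := hcases m 0
      · rw [add_zero] at h
        rwa [h]
      · rw [add_zero] at h2
        exact Or.inr h2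
      · rw [add_zero] at h2
        exact Or.inl h2
    classical
    let A : ℤ → Fin 2 := fun m => if α m = 1 then 1 else 0
    have hA0 : ∀ m, α m = 0 → A m = 0 := fun m h => by simp [A, h]
    have hA1 : ∀ m, α m = 1 → A m = 1 := fun m h => by simp [A, h]
    obtain ⟨g, hg, h⟩ := hP.exists_rescaling hne (ψ := coeffA A β) (coeffA_relation A β) (by
      intro j m
      obtain ⟨c, hc, ⟨h', h⟩ | ⟨h1, h2, h⟩ | ⟨h1, h2, h⟩⟩ := hcases j m
      · refine ⟨c, hc, fun x s => ?_⟩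
        rw [h, coeffA]
        rcases h01 m with h1 | h1 <;> rw [h1] at h'
        · simp [hA0 _ h1, hA0 _ h', h1]
        · simp [hA1 _ h1, hA1 _ h', h1]
          left
          ring
      · refine ⟨c, hc, fun x s => ?_⟩
        simp [h, coeffA, hA0 _ h1, hA1 _ h2]
      · refine ⟨c, hc, fun x s => ?_⟩
        simp [h, coeffA, hA1 _ h1, hA0 _ h2])
    refine ⟨g, hg, Or.inr ⟨A, ?_, h⟩⟩
    -- The jump is oriented from weight 1 to weight 0, where the coefficient is quadratic in `∂`;
    -- this orientation later excludes `d ≠ 0`.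
    rcases h00 with h1 | h1
    · refine ⟨-m0, m0, hA1 _ ((h01 m0).resolve_left (h1 ▸ hm0)), ?_⟩
      rw [neg_add_cancel]
      exact hA0 _ h1
    · refine ⟨m0, 0, hA1 _ h1, ?_⟩
      rw [add_zero]
      exact hA0 _ ((h01 m0).resolve_right (h1 ▸ hm0))

/-! ### Coefficients of the action of `M_i` and `Y_i` -/

/-- `P`, `G`, `H` are the coefficients of `L_i`, `M_i`, `Y_i` in a graded module over `CSV(a,b)`
with one free generator in each degree. -/
structure IsCSVCoefficients (a b : ℂ) (P G H : ℤ → ℤ → ℂ[X][X]) : Prop where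
  LL : IsLoopVirasoro P
  LM : ∀ i j m x s t, (G j m).evalEval t (x + s) * (P i (j + m)).evalEval s x -
    (P i m).evalEval s (x + t) * (G j (i + m)).evalEval t x =
      ((a - 1) * s - t + b) * (G (i + j) m).evalEval (s + t) x
  LY : ∀ i j m x s t, (H j m).evalEval t (x + s) * (P i (j + m)).evalEval s x -
    (P i m).evalEval s (x + t) * (H j (i + m)).evalEval t x =
      (a / 2 * s - t + b / 2) * (H (i + j) m).evalEval (s + t) x
  YY : ∀ i j m x s t, (H j m).evalEval t (x + s) * (H i (j + m)).evalEval s x -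
    (H i m).evalEval s (x + t) * (H j (i + m)).evalEval t x =
      (s - t) * (G (i + j) m).evalEval (s + t) x
  MM : ∀ i j m x s t, (G j m).evalEval t (x + s) * (G i (j + m)).evalEval s x -
    (G i m).evalEval s (x + t) * (G j (i + m)).evalEval t x = 0

namespace IsCSVCoefficients

variable {a b : ℂ} {P G H : ℤ → ℤ → ℂ[X][X]}

theorem natDegree_M_zero (h : IsCSVCoefficients a b P G H) (m : ℤ) : (G 0 m).natDegree = 0 := by
  have := natDegree_le_of_commutator (P := G 0 m) (R := 0) (fun x s t => by
    simpa using h.MM 0 0 m x s t)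
  rw [natDegree_zero] at this
  omega

theorem natDegree_Y_zero (h : IsCSVCoefficients a b P G H) (m : ℤ) : (H 0 m).natDegree = 0 := by
  have := natDegree_le_of_commutator (P := H 0 m) (R := G 0 m) (fun x s t => by
    simpa using h.YY 0 0 m x s t)
  rw [h.natDegree_M_zero] at this
  omega

/-- `Y_0` is free of `∂`, so its two values at `λ = s` and `λ = 0` commute, and the relation for
`[Y_0, Y_0]` gives `M_0 = 0`. The bracket of `L_i` with `M_0` then gives `M_i = 0`, since its factor
`b - t` is a nonzero polynomial. -/
theorem M_eq_zero (h : IsCSVCoefficients a b P G H) (i m : ℤ) : G i m = 0 := by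
  have h0 : ∀ m, G 0 m = 0 := by
    intro m
    refine bivariate_mul_linear_eq_zero 0 1 0 (by simp) fun x s => ?_
    have e := h.YY 0 0 m x s 0
    rw [zero_add, add_zero, evalEval_eq_of_natDegree_eq_zero (h.natDegree_Y_zero m) (x + s) x]
      at e
    simp only [add_zero, sub_zero] at e
    linear_combination -e
  refine bivariate_mul_linear_eq_zero 0 (-1) b (by simp) fun x s => ?_
  have e := h.LM i 0 m x 0 s
  simp only [h0, evalEval_zero, add_zero, zero_add] at e
  linear_combination -e

theorem Y_eq_zero_of_zero (h : IsCSVCoefficients a b P G H) (h0 : ∀ m, H 0 m = 0) (i m : ℤ) :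
    H i m = 0 := by
  refine bivariate_mul_linear_eq_zero 0 (-1) (b / 2) (by simp) fun x s => ?_
  have e := h.LY i 0 m x 0 s
  simp only [h0, evalEval_zero, add_zero, zero_add] at e
  linear_combination -e

/-- Together with `M_eq_zero` this shows that a nontrivial module has a nontrivial `L`-action. -/
theorem Y_eq_zero_of_L (h : IsCSVCoefficients a b P G H) (h0 : ∀ i m, P i m = 0) (i m : ℤ) :
    H i m = 0 := by
  refine bivariate_mul_linear_eq_zero 0 (-1) (b / 2) (by simp) fun x s => ?_
  have e := h.LY 0 i m x 0 s
  simp only [h0, evalEval_zero, zero_add] at e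
  linear_combination -e

/-- Because `Y_0` is free of `∂`, the weight `α` and `β` cancel from the commutator with `L_0`. At
`t = 0` the relation kills `Y_0` when `(a, b) ≠ (0, 0)`; for `a = b = 0` it says that `Y_0` does not
depend on `λ`. -/
theorem Y_zero_relation (h : IsCSVCoefficients a b P G H) {β α : ℂ} {m : ℤ}
    (hP : ∀ x s, (P 0 m).evalEval s x = x + α * s + β) (x s t : ℂ) :
    -t * (H 0 m).evalEval t x = (a / 2 * s - t + b / 2) * (H 0 m).evalEval (s + t) x := by
  have e := h.LY 0 0 m x s t
  simp only [zero_add, hP] at e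
  rw [evalEval_eq_of_natDegree_eq_zero (h.natDegree_Y_zero m) (x + s) x] at e
  linear_combination e

theorem Y_zero_eq_zero (h : IsCSVCoefficients a b P G H) (hab : a ≠ 0 ∨ b ≠ 0) {β α : ℂ} {m : ℤ}
    (hP : ∀ x s, (P 0 m).evalEval s x = x + α * s + β) : H 0 m = 0 := by
  refine bivariate_mul_linear_eq_zero 0 (a / 2) (b / 2) (by simpa using hab) fun x s => ?_
  have e := h.Y_zero_relation hP x s 0
  rw [add_zero] at e
  linear_combination -e

theorem Y_zero_const (h : IsCSVCoefficients 0 0 P G H) {β α : ℂ} {m : ℤ}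
    (hP : ∀ x s, (P 0 m).evalEval s x = x + α * s + β) (x s : ℂ) :
    (H 0 m).evalEval s x = (H 0 m).evalEval 1 0 := by
  have e := h.Y_zero_relation hP x (s - 1) 1
  rw [sub_add_cancel] at e
  rw [evalEval_eq_of_natDegree_eq_zero (h.natDegree_Y_zero m) 0 x]
  linear_combination e

theorem exists_Y_zero (h : IsCSVCoefficients a b P G H) (hne : ∃ j m, P j m ≠ 0) :
    ∃ d : ℂ, (a ≠ 0 ∨ b ≠ 0 → d = 0) ∧ (∀ m x s, (H 0 m).evalEval s x = d) ∧
      ∀ i m x s t, d * ((P i m).evalEval s x - (P i m).evalEval s (x + t)) =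
        (a / 2 * s - t + b / 2) * (H i m).evalEval (s + t) x := by
  obtain ⟨hne, β, α, hP⟩ := h.LL.exists_weights hne
  by_cases hab : a ≠ 0 ∨ b ≠ 0
  · have h0 : ∀ m, H 0 m = 0 := fun m => h.Y_zero_eq_zero hab (hP m)
    exact ⟨0, fun _ => rfl, fun m x s => by rw [h0, evalEval_zero], fun i m x s t => by
      rw [h.Y_eq_zero_of_zero h0, evalEval_zero, zero_mul, mul_zero]⟩
  · push Not at hab
    obtain ⟨rfl, rfl⟩ := hab
    have h0 : ∀ m x s, (H 0 m).evalEval s x = (H 0 m).evalEval 1 0 := fun m =>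
      h.Y_zero_const (hP m)
    have h1 : ∀ m, (H 0 m).evalEval 1 0 = (H 0 0).evalEval 1 0 := by
      intro m
      by_contra hne'
      -- The constant is the same in degrees 0 and `m` because `L_m` is nonzero between them and
      -- commutes with `Y_0` at `t = 0`.
      refine hne m 0 (bivariate_mul_linear_eq_zero 0 0
        ((H 0 m).evalEval 1 0 - (H 0 0).evalEval 1 0)
        (Or.inr (Or.inr (sub_ne_zero.2 hne'))) fun x s => ?_)
      have e := h.LY m 0 0 x s 0
      simp only [add_zero, h0 0, h0 m] at e
      linear_combination -e
    have h2 : ∀ m x s, (H 0 m).evalEval s x = (H 0 0).evalEval 1 0 := fun m x s => by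
      rw [h0, h1]
    refine ⟨(H 0 0).evalEval 1 0, by simp, h2, fun i m x s t => ?_⟩
    have e := h.LY i 0 m x s t
    simp only [h2, add_zero, zero_add] at e
    linear_combination e

theorem Y_eq_zero (h : IsCSVCoefficients a b P G H) {d : ℂ} (hd : d = 0)
    (h0 : ∀ m x s, (H 0 m).evalEval s x = d) (i m : ℤ) : H i m = 0 :=
  h.Y_eq_zero_of_zero (fun m => bivariate_eq_zero fun x s => by rw [h0, hd]) i m

theorem Y_indep (h : IsCSVCoefficients a b P G H) {d : ℂ} (hd : d ≠ 0)
    (h0 : ∀ m x s, (H 0 m).evalEval s x = d) (i m : ℤ) (x s t : ℂ) :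
    (H i m).evalEval t (x + s) = (H i m).evalEval t x := by
  have e := h.YY 0 i m x s t
  simp only [h0, h.M_eq_zero, evalEval_zero, zero_add, mul_zero] at e
  refine mul_left_cancel₀ hd ?_
  linear_combination e

end IsCSVCoefficients
end

noncomputable section
/-! ### Graded free intermediate series modules in terms of coefficients -/

theorem C_smul_eq_smul {V : Type*} [AddCommGroup V] [Module ℂ V] [Module ℂ[X] V]
    [IsScalarTower ℂ ℂ[X] V] (c : ℂ) (v : V) : (C c : ℂ[X]) • v = c • v := by
  rw [← algebraMap_smul ℂ[X] c v]
  rfl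

theorem X_add_C_smul {V : Type*} [AddCommGroup V] [Module ℂ V] [Module ℂ[X] V]
    [IsScalarTower ℂ ℂ[X] V] (c : ℂ) (v : V) :
    (X + C c : ℂ[X]) • v = (X : ℂ[X]) • v + c • v := by
  rw [add_smul, C_smul_eq_smul]

theorem IsConformalModule.act_smul_right {R V : Type*} [AddCommGroup R] [Module ℂ R]
    [Module ℂ[X] R] [IsScalarTower ℂ ℂ[X] R] [AddCommGroup V] [Module ℂ V] [Module ℂ[X] V]
    [IsScalarTower ℂ ℂ[X] V] {S : LieConformalAlgebra R} {act : ℂ → R →ₗ[ℂ] V →ₗ[ℂ] V}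
    (h : IsConformalModule S act) (t : ℂ) (r : R) (p : ℂ[X]) (v : V) :
    act t r (p • v) = p.comp (X + C t) • act t r v := by
  induction p using Polynomial.induction_on generalizing v with
  | C c => rw [C_smul_eq_smul, map_smul, C_comp, C_smul_eq_smul]
  | add p q hp hq => rw [add_smul, map_add, hp, hq, add_comp, add_smul]
  | monomial n c ih =>
    rw [pow_succ, ← mul_assoc, mul_smul, ih, h.sesq_right, smul_smul, ← mul_X_comp]

theorem IsConformalModule.act_smul_left {R V : Type*} [AddCommGroup R] [Module ℂ R]
    [Module ℂ[X] R] [IsScalarTower ℂ ℂ[X] R] [AddCommGroup V] [Module ℂ V] [Module ℂ[X] V]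
    [IsScalarTower ℂ ℂ[X] V] {S : LieConformalAlgebra R} {act : ℂ → R →ₗ[ℂ] V →ₗ[ℂ] V}
    (h : IsConformalModule S act) (t : ℂ) (p : ℂ[X]) (r : R) (v : V) :
    act t (p • r) v = p.eval (-t) • act t r v := by
  induction p using Polynomial.induction_on generalizing r with
  | C c => rw [C_smul_eq_smul, map_smul, eval_C, LinearMap.smul_apply]
  | add p q hp hq => rw [add_smul, map_add, LinearMap.add_apply, hp, hq, eval_add, add_smul]
  | monomial n c ih =>
    rw [pow_succ, ← mul_assoc, mul_smul, ih, h.sesq_left, ← neg_smul, smul_smul, ← eval_mul_X]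

theorem exists_basis_of_isInternal {V : Type*} [AddCommGroup V] [Module ℂ[X] V]
    {VV : ℤ → Submodule ℂ[X] V} (h : DirectSum.IsInternal VV)
    (hfree : ∀ i, ∃ v : V, VV i = Submodule.span ℂ[X] {v} ∧ ∀ p : ℂ[X], p • v = 0 → p = 0) :
    ∃ B : Module.Basis ℤ ℂ[X] V, ∀ m, VV m = Submodule.span ℂ[X] {B m} := by
  choose v hspan hv using hfree
  have hmem : ∀ i, v i ∈ VV i := fun i => by
    rw [hspan]
    exact Submodule.mem_span_singleton_self _
  let b : ∀ i, Module.Basis Unit ℂ[X] (VV i) := fun i =>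
    Module.Basis.mk (v := fun _ => ⟨v i, hmem i⟩) (by
      rw [Fintype.linearIndependent_iff]
      intro g hg j
      simp only [Finset.univ_unique, Finset.sum_singleton] at hg
      exact hv i _ (congrArg Subtype.val hg)) (by
      rintro ⟨w, hw⟩ -
      obtain ⟨p, rfl⟩ := Submodule.mem_span_singleton.1 (hspan i ▸ hw)
      have hw' : (⟨p • v i, hw⟩ : VV i) = p • ⟨v i, hmem i⟩ := rfl
      rw [hw']
      exact Submodule.smul_mem _ p (Submodule.subset_span (Set.mem_range_self ())))
  refine ⟨(h.collectedBasis b).reindex (Equiv.sigmaPUnit ℤ), fun m => ?_⟩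
  rw [hspan]
  congr 2
  simp [b]

/-- `x i _λ b m = P i m b (i + m)` -/
def HasCoefficients {V : Type*} [AddCommGroup V] [Module ℂ V] [Module ℂ[X] V]
    (act : ℂ → CSVCarrier →ₗ[ℂ] V →ₗ[ℂ] V) (b : ℤ → V) (x : ℤ → CSVGen)
    (P : ℤ → ℤ → ℂ[X][X]) : Prop :=
  ∀ t i m, act t (Finsupp.single (x i) 1) (b m) = (P i m).map (evalRingHom t) • b (i + m)

section

variable {V : Type*} [AddCommGroup V] [Module ℂ V] [Module ℂ[X] V] [IsScalarTower ℂ ℂ[X] V]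
  {act : ℂ → CSVCarrier →ₗ[ℂ] V →ₗ[ℂ] V} {VV : ℤ → Submodule ℂ[X] V} {a b : ℂ}
  {B : Module.Basis ℤ ℂ[X] V}

theorem exists_hasCoefficients
    (h : IsGradedFreeIntermediateSeries (CSV a b) csvGrading act VV)
    (hB : ∀ m, VV m = Submodule.span ℂ[X] {B m}) (x : ℤ → CSVGen)
    (hx : ∀ i, Finsupp.single (x i) 1 ∈ csvGrading i) : ∃ P, HasCoefficients act B x P := by
  have key : ∀ i m, ∃ Q : ℂ[X][X], ∀ t,
      act t (Finsupp.single (x i) 1) (B m) = Q.map (evalRingHom t) • B (i + m) := by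
    intro i m
    obtain ⟨F, hF⟩ := h.isConformalModule.polynomial (Finsupp.single (x i) 1) (B m)
    -- The individual `F n` are not known to be homogeneous, so only their coordinate in degree `i +
    -- m` is kept. The exponent `n` counts powers of `λ`, the inner variable.
    refine ⟨∑ n ∈ F.support, (B.repr (F n) (i + m)).map C * C (X ^ n), fun t => ?_⟩
    have hmem := h.act_mem i m _ (hx i) (B m)
      (by rw [hB]; exact Submodule.mem_span_singleton_self _) t
    rw [hB, Submodule.mem_span_singleton] at hmem
    obtain ⟨p, hp⟩ := hmem
    have h1 : p = B.repr (act t (Finsupp.single (x i) 1) (B m)) (i + m) := by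
      rw [← hp]
      simp
    rw [← hp, h1]
    congr 1
    have hFt : act t (Finsupp.single (x i) 1) (B m) = _ := hF t
    rw [hFt, Finsupp.sum, map_sum, Finsupp.finsetSum_apply, Polynomial.map_sum]
    refine Finset.sum_congr rfl fun n _ => ?_
    rw [← C_smul_eq_smul, map_smul, Polynomial.map_mul, Polynomial.map_map, map_C]
    have : (evalRingHom t).comp C = RingHom.id ℂ := RingHom.ext fun c => by simp
    rw [this, Polynomial.map_id, coe_evalRingHom, eval_pow, eval_X, Finsupp.smul_apply,
      smul_eq_mul, mul_comm]
  choose P hP using key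
  exact ⟨P, fun t i m => hP i m t⟩

/-- On the left argument of the action at `λ = s + t` the derivation `∂` becomes `-(s + t)`, which
turns the structure polynomial `q` of the bracket into a scalar. -/
theorem commutator_coefficients (h : IsConformalModule (CSV a b) act) {x y z : ℤ → CSVGen}
    {P Q R : ℤ → ℤ → ℂ[X][X]} (hP : HasCoefficients act B x P) (hQ : HasCoefficients act B y Q)
    (hR : HasCoefficients act B z R) {i j : ℤ} {s : ℂ} {q : ℂ[X]}
    (hq : csvGenBracket a b s (x i) (y j) = Finsupp.single (z (i + j)) q) (m : ℤ) (w t : ℂ) :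
    (Q j m).evalEval t (w + s) * (P i (j + m)).evalEval s w -
      (P i m).evalEval s (w + t) * (Q j (i + m)).evalEval t w =
      q.eval (-(s + t)) * (R (i + j) m).evalEval (s + t) w := by
  have h1 := h.commutator s t (Finsupp.single (x i) 1) (Finsupp.single (y j) 1) (B m)
  have h2 : (CSV a b).bracket s (Finsupp.single (x i) 1) (Finsupp.single (y j) 1) =
      q • Finsupp.single (z (i + j)) 1 := by
    change sesqExt s (csvGenBracket a b s) _ _ = _
    rw [sesqExt_single, hq]
    simp
  rw [h2, h.act_smul_left, hP, hQ, hR, h.act_smul_right, h.act_smul_right, hP, hQ,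
    ← C_smul_eq_smul, smul_smul, smul_smul, smul_smul, add_left_comm j i m, ← add_assoc i j m,
    ← sub_smul] at h1
  have h3 := congrArg (fun v => (B.repr v (i + j + m)).eval w) h1
  simp only [map_smul, Module.Basis.repr_self, Finsupp.smul_apply, Finsupp.single_eq_same,
    smul_eq_mul, mul_one, eval_sub, eval_mul, eval_comp, eval_add, eval_X, eval_C,
    eval_map_evalRingHom_eq_evalEval] at h3
  exact h3

theorem isCSVCoefficients (h : IsConformalModule (CSV a b) act) {P G H : ℤ → ℤ → ℂ[X][X]}
    (hP : HasCoefficients act B .L P) (hG : HasCoefficients act B .M G)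
    (hH : HasCoefficients act B .Y H) : IsCSVCoefficients a b P G H where
  LL i j m x s t := by
    rw [commutator_coefficients h hP hP hP rfl]
    simp
    left
    ring
  LM i j m x s t := by
    rw [commutator_coefficients h hP hG hG rfl]
    simp
    left
    ring
  LY i j m x s t := by
    rw [commutator_coefficients h hP hH hH rfl]
    simp
    left
    ring
  YY i j m x s t := by
    rw [commutator_coefficients h hH hH hG rfl]
    simp
    left
    ring
  MM i j m x s t := by
    rw [commutator_coefficients h hG hG hG (q := 0) (by simp [csvGenBracket])]
    simp

/-- By sesquilinearity an action is determined by its values on generators; this is what turns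
equality of coefficients into an isomorphism of modules. -/
theorem repr_act (h : IsConformalModule (CSV a b) act) {K : ℂ → CSVGen → ℤ → SeriesCarrier}
    (hK : ∀ t x m, B.repr (act t (Finsupp.single x 1) (B m)) = K t x m) (t : ℂ)
    (r : CSVCarrier) (v : V) : B.repr (act t r v) = sesqExt t (K t) r (B.repr v) := by
  obtain ⟨w, rfl⟩ := B.repr.symm.surjective v
  rw [LinearEquiv.apply_symm_apply]
  have hsm : ∀ (c : ℂ) (v : V), B.repr (c • v) = c • B.repr v := fun c v => by
    rw [← C_smul_eq_smul, map_smul, C_smul_eq_smul]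
  have hsm' : ∀ (c : ℂ) (w : SeriesCarrier), B.repr.symm (c • w) = c • B.repr.symm w :=
    fun c v => by rw [← C_smul_eq_smul, map_smul, C_smul_eq_smul]
  induction r using csv_induction with
  | h0 => simp
  | hadd r q hr hq => simp only [map_add, LinearMap.add_apply, hr, hq]
  | hsmul c r hr => simp only [map_smul, LinearMap.smul_apply, hsm, hr]
  | hX r hr => simp only [h.sesq_left, sesqExt_X_left, map_neg, hsm, hr]
  | hgen x =>
  induction w using csv_induction with
  | h0 => simp
  | hadd r q hr hq => simp only [map_add, hr, hq]
  | hsmul c r hr => simp only [hsm', map_smul, hsm, hr]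
  | hX r hr => rw [map_smul, h.sesq_right, map_smul, hr, sesqExt_X_right]
  | hgen m =>
    rw [Module.Basis.repr_symm_single_one, hK, sesqExt_single]
    simp

theorem gradedConformalIso_of_coefficients (h : IsConformalModule (CSV a b) act)
    (hB : ∀ m, VV m = Submodule.span ℂ[X] {B m}) {f : ℂ → ℤ → ℤ → ℂ[X]} {d : ℂ}
    (hL : ∀ t i m, act t (Finsupp.single (.L i) 1) (B m) = f t i m • B (i + m))
    (hM : ∀ t i m, act t (Finsupp.single (.M i) 1) (B m) = 0)
    (hY : ∀ t i m, act t (Finsupp.single (.Y i) 1) (B m) = (C d : ℂ[X]) • B (i + m)) :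
    GradedConformalIso act VV (seriesAction f d) seriesGrading := by
  refine ⟨B.repr, fun t r v => ?_, fun m => ?_⟩
  · refine repr_act (K := fun t x m => match x with
      | .L i => Finsupp.single (i + m) (f t i m)
      | .M _ => 0
      | .Y i => Finsupp.single (i + m) (C d)) h ?_ t r v
    rintro t (i | i | i) m
    · simp [hL]
    · simp [hM]
    · simp [hY]
  · rw [hB, Submodule.map_span, Set.image_singleton, seriesGrading]
    simp

theorem single_mem_csvGrading (i : ℤ) : Finsupp.single (.L i) 1 ∈ csvGrading i ∧
    Finsupp.single (.M i) 1 ∈ csvGrading i ∧ Finsupp.single (.Y i) 1 ∈ csvGrading i :=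
  ⟨Submodule.subset_span (by simp), Submodule.subset_span (by simp),
    Submodule.subset_span (by simp)⟩

theorem exists_isCSVCoefficients
    (h : IsGradedFreeIntermediateSeries (CSV a b) csvGrading act VV)
    (hB : ∀ m, VV m = Submodule.span ℂ[X] {B m}) : ∃ P G H, HasCoefficients act B .L P ∧
      HasCoefficients act B .M G ∧ HasCoefficients act B .Y H ∧ IsCSVCoefficients a b P G H := by
  obtain ⟨P, hP⟩ := exists_hasCoefficients h hB .L fun i => (single_mem_csvGrading i).1
  obtain ⟨G, hG⟩ := exists_hasCoefficients h hB .M fun i => (single_mem_csvGrading i).2.1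
  obtain ⟨H, hH⟩ := exists_hasCoefficients h hB .Y fun i => (single_mem_csvGrading i).2.2
  exact ⟨P, G, H, hP, hG, hH, isCSVCoefficients h.isConformalModule hP hG hH⟩

theorem exists_L_ne_zero (h : IsConformalModule (CSV a b) act) (hact : IsNontrivialAction act)
    {P G H : ℤ → ℤ → ℂ[X][X]} (hP : HasCoefficients act B .L P)
    (hG : HasCoefficients act B .M G) (hH : HasCoefficients act B .Y H)
    (hc : IsCSVCoefficients a b P G H) : ∃ j m, P j m ≠ 0 := by
  by_contra! h0
  obtain ⟨t, r, v, hne⟩ := hact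
  refine hne (B.repr.injective ?_)
  rw [repr_act (K := fun _ _ _ => 0) h, sesqExt_apply]
  · simp
  rintro t (i | i | i) m
  · rw [hP t i m, h0]
    simp
  · rw [hG t i m, hc.M_eq_zero]
    simp
  · rw [hH t i m, hc.Y_eq_zero_of_L h0]
    simp

theorem exists_normal_basis
    (h : IsGradedFreeIntermediateSeries (CSV a b) csvGrading act VV)
    (hact : IsNontrivialAction act) : ∃ (B : Module.Basis ℤ ℂ[X] V) (β : ℂ),
      (∀ m, VV m = Submodule.span ℂ[X] {B m}) ∧
      ((∃ α : ℂ, ∀ t i m,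
        act t (Finsupp.single (.L i) 1) (B m) = (X + C (α * t + β) : ℂ[X]) • B (i + m)) ∨
      ∃ A : ℤ → Fin 2, (∃ j m, A m = 1 ∧ A (j + m) = 0) ∧ ∀ t i m,
        act t (Finsupp.single (.L i) 1) (B m) = coeffA A β t i m • B (i + m)) := by
  obtain ⟨B, hB⟩ := exists_basis_of_isInternal h.isInternal h.free_one
  obtain ⟨P, G, H, hP, hG, hH, hc⟩ := exists_isCSVCoefficients h hB
  obtain ⟨β, g, hg, hcases⟩ := hc.LL.normal_form
    (exists_L_ne_zero h.isConformalModule hact hP hG hH hc)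
  -- The rescaling of the normal form is realised by a change of basis within each degree.
  have hu : ∀ m, IsUnit (C (g m) : ℂ[X]) := fun m => isUnit_C.2 (hg m).isUnit
  have key : ∀ (t : ℂ) (i m : ℤ) (f : ℂ[X]),
      (∀ x, g m * (P i m).evalEval t x = g (i + m) * f.eval x) →
      act t (Finsupp.single (.L i) 1) ((B.isUnitSMul hu) m) = f • (B.isUnitSMul hu) (i + m) := by
    intro t i m f hf
    rw [Module.Basis.isUnitSMul_apply, Module.Basis.isUnitSMul_apply, C_smul_eq_smul, map_smul,
      hP, ← C_smul_eq_smul, smul_smul, smul_smul]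
    congr 1
    refine Polynomial.funext fun x => ?_
    rw [eval_mul, eval_mul, eval_C, eval_C, eval_map_evalRingHom_eq_evalEval, hf, mul_comm]
  refine ⟨B.isUnitSMul hu, β, fun m => ?_, ?_⟩
  · rw [hB, Module.Basis.isUnitSMul_apply, Submodule.span_singleton_smul_eq (hu m)]
  · rcases hcases with ⟨α, hα⟩ | ⟨A, hA, hAc⟩
    · exact Or.inl ⟨α, fun t i m => key t i m _ fun x => hα i m x t⟩
    · exact Or.inr ⟨A, hA, fun t i m => key t i m _ fun x => hAc i m x t⟩

/-- For constant `A` the module `V_{A,β,d}` is `V_{α,β,d}` with `α` equal to 0 or 1. Hence the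
second alternative is needed only for nonconstant `A`, and there `d = 0`. -/
theorem classification
    (h : IsGradedFreeIntermediateSeries (CSV a b) csvGrading act VV)
    (hact : IsNontrivialAction act) : ∃ β d : ℂ, (a ≠ 0 ∨ b ≠ 0 → d = 0) ∧
      ((∃ α, GradedConformalIso act VV (actVd α β d) seriesGrading) ∨
      ∃ A, d = 0 ∧ GradedConformalIso act VV (actA A β) seriesGrading) := by
  obtain ⟨B, β, hB, hcases⟩ := exists_normal_basis h hact
  obtain ⟨P, G, H, hP, hG, hH, hc⟩ := exists_isCSVCoefficients h hB
  obtain ⟨d, hd, hH0, hHP⟩ := hc.exists_Y_zero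
    (exists_L_ne_zero h.isConformalModule hact hP hG hH hc)
  have hPf : ∀ t i m (f : ℂ[X]), act t (Finsupp.single (.L i) 1) (B m) = f • B (i + m) →
      ∀ x, (P i m).evalEval t x = f.eval x := by
    intro t i m f hf x
    rw [hP] at hf
    have := congrArg (fun v => (B.repr v (i + m)).eval x) hf
    simpa [eval_map_evalRingHom_eq_evalEval] using this
  have hM : ∀ t i m, act t (Finsupp.single (.M i) 1) (B m) = 0 := fun t i m => by
    rw [hG t i m, hc.M_eq_zero, Polynomial.map_zero, zero_smul]
  have hYd : d = 0 → ∀ t i m, act t (Finsupp.single (.Y i) 1) (B m) =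
      (C d : ℂ[X]) • B (i + m) := fun h0 t i m => by
    rw [hH t i m, hc.Y_eq_zero h0 hH0, h0, C_0, Polynomial.map_zero]
  refine ⟨β, d, hd, ?_⟩
  rcases hcases with ⟨α, hL⟩ | ⟨A, ⟨j, m, hA1, hA0⟩, hL⟩
  · refine Or.inl ⟨α, gradedConformalIso_of_coefficients h.isConformalModule hB hL hM ?_⟩
    by_cases h0 : d = 0
    · exact hYd h0
    · intro t i m
      rw [hH t i m]
      congr 1
      refine Polynomial.funext fun x => ?_
      rw [eval_map_evalRingHom_eq_evalEval, eval_C]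
      have hab : a = 0 ∧ b = 0 := by
        by_contra hab
        exact h0 (hd (not_and_or.1 hab))
      -- For `L`-coefficients with leading term `∂`, the difference over the step 1 is constant, so
      -- `Y_i` acts by `d`.
      have e := hHP i m x (t - 1) 1
      rw [hPf _ i m _ (hL _ i m), hPf _ i m _ (hL _ i m), hab.1, hab.2, sub_add_cancel] at e
      simp only [eval_add, eval_X, eval_C] at e
      linear_combination e
  · have h0 : d = 0 := by
      by_contra h0
      have hab : a = 0 ∧ b = 0 := by
        by_contra hab
        exact h0 (hd (not_and_or.1 hab))
      have hH' : ∀ x s t, d * ((coeffA A β s j m).eval x - (coeffA A β s j m).eval (x + t)) =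
          -t * (H j m).evalEval (s + t) x := by
        intro x s t
        have e := hHP j m x s t
        rw [hPf _ j m _ (hL _ j m), hPf _ j m _ (hL _ j m), hab.1, hab.2] at e
        linear_combination e
      -- At the jump, `Y_j` is `d` times a difference of `(∂ + β)²`, namely `d (2x + 2β + 1)` at `λ
      -- = 1`. Its values at `x = 0` and `x = 1` differ by `2d`, while `Y_indep` makes them equal.
      have e0 := hH' 0 0 1
      have e1 := hH' 1 0 1
      have e2 := hc.Y_indep h0 hH0 j m 0 1 1
      simp only [coeffA, hA0, hA1, eval_mul, eval_add, eval_X, eval_C, zero_add] at e0 e1 e2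
      rw [e2] at e1
      have : 2 * d = 0 := by linear_combination e0 - e1
      exact h0 (by simpa using this)
    refine Or.inr ⟨A, h0, ?_⟩
    have := gradedConformalIso_of_coefficients h.isConformalModule hB hL hM (hYd h0)
    rw [h0] at this
    exact this

end

/-! ### The modules `V_{α,β,d}` and `V_{A,β,d}` -/

theorem isPolynomialFamily_zero {V : Type*} [AddCommGroup V] [Module ℂ V] :
    IsPolynomialFamily fun _ : ℂ => (0 : V) := ⟨0, by simp⟩

theorem IsPolynomialFamily.add {V : Type*} [AddCommGroup V] [Module ℂ V] {f g : ℂ → V}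
    (hf : IsPolynomialFamily f) (hg : IsPolynomialFamily g) :
    IsPolynomialFamily fun t => f t + g t := by
  obtain ⟨P, hP⟩ := hf
  obtain ⟨Q, hQ⟩ := hg
  refine ⟨P + Q, fun t => ?_⟩
  change f t + g t = _
  rw [hP, hQ, Finsupp.sum_add_index' (by simp) (by simp)]

theorem IsPolynomialFamily.map {V W : Type*} [AddCommGroup V] [Module ℂ V] [AddCommGroup W]
    [Module ℂ W] {f : ℂ → V} (hf : IsPolynomialFamily f) (e : V →ₗ[ℂ] W) :
    IsPolynomialFamily fun t => e (f t) := by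
  obtain ⟨P, hP⟩ := hf
  refine ⟨P.mapRange e (map_zero e), fun t => ?_⟩
  change e (f t) = _
  rw [hP, Finsupp.sum_mapRange_index (by simp), Finsupp.sum, map_sum]
  simp [Finsupp.sum]

theorem IsPolynomialFamily.smul_self {V : Type*} [AddCommGroup V] [Module ℂ V] {f : ℂ → V}
    (hf : IsPolynomialFamily f) : IsPolynomialFamily fun t => t • f t := by
  obtain ⟨P, hP⟩ := hf
  refine ⟨P.mapDomain (· + 1), fun t => ?_⟩
  change t • f t = _
  rw [hP, Finsupp.sum_mapDomain_index (by simp) (by simp [smul_add]), Finsupp.smul_sum]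
  simp [pow_succ', mul_smul]

theorem isPolynomialFamily_const {V : Type*} [AddCommGroup V] [Module ℂ V] (v : V) :
    IsPolynomialFamily fun _ : ℂ => v :=
  ⟨Finsupp.single 0 v, fun t => by rw [Finsupp.sum_single_index] <;> simp⟩

theorem isPolynomialFamily_sesqExt {K : ℂ → CSVGen → ℤ → SeriesCarrier}
    (hK : ∀ x m, IsPolynomialFamily fun t => K t x m) (r : CSVCarrier) (v : SeriesCarrier) :
    IsPolynomialFamily fun t => sesqExt t (K t) r v := by
  induction r using csv_induction with
  | h0 => simpa using isPolynomialFamily_zero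
  | hadd r q hr hq => simpa only [map_add, LinearMap.add_apply] using hr.add hq
  | hsmul c r hr =>
    simp only [map_smul, LinearMap.smul_apply]
    exact hr.map (c • LinearMap.id)
  | hX r hr =>
    simp only [sesqExt_X_left]
    exact hr.smul_self.map (-LinearMap.id)
  | hgen x =>
  induction v using csv_induction with
  | h0 => simpa using isPolynomialFamily_zero
  | hadd r q hr hq => simpa only [map_add] using hr.add hq
  | hsmul c r hr =>
    simp only [map_smul]
    exact hr.map (c • LinearMap.id)
  | hX r hr =>
    simp only [sesqExt_X_right, X_add_C_smul]
    exact (hr.map ((LinearMap.lsmul ℂ[X] SeriesCarrier X).restrictScalars ℂ)).add hr.smul_self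
  | hgen m => simpa [sesqExt_single] using hK x m

/-- Sesquilinearity reduces the commutator to generators. There `hf` is the relation for two `L`'s
and `hd` the one for `L` and `Y` in either order; two `Y`'s commute as constants, in accordance with
`M` acting by zero. -/
theorem seriesAction_commutator {a b d : ℂ} {f : ℂ → ℤ → ℤ → ℂ[X]}
    (hf : ∀ i j m x s t, (f t j m).eval (x + s) * (f s i (j + m)).eval x -
      (f s i m).eval (x + t) * (f t j (i + m)).eval x = (s - t) * (f (s + t) (i + j) m).eval x)
    (hd : ∀ i j m x s t, d * (f s i (j + m)).eval x - (f s i m).eval (x + t) * d =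
      (a / 2 * s - t + b / 2) * d) (s t : ℂ) (x y : CSVCarrier) (z : SeriesCarrier) :
    seriesAction f d s x (seriesAction f d t y z) - seriesAction f d t y (seriesAction f d s x z) =
      seriesAction f d (s + t) (sesqExt s (csvGenBracket a b s) x y) z := by
  rw [sub_eq_iff_eq_add]
  unfold seriesAction
  induction x using csv_induction with
  | h0 => simp
  | hadd r q hr hq => simp only [map_add, LinearMap.add_apply, hr, hq]; abel
  | hsmul c r hr => simp only [map_smul, LinearMap.smul_apply, hr, smul_add]
  | hX r hr =>
    simp only [sesqExt_X_left, map_neg, map_smul, LinearMap.neg_apply, LinearMap.smul_apply, hr,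
      smul_add, neg_add]
  | hgen x =>
  induction y using csv_induction with
  | h0 => simp
  | hadd r q hr hq => simp only [map_add, LinearMap.add_apply, hr, hq]; abel
  | hsmul c r hr => simp only [map_smul, LinearMap.smul_apply, hr, smul_add]
  | hX r hr =>
    simp only [sesqExt_X_left, sesqExt_X_right, X_add_C_smul, map_neg, map_smul, map_add,
      LinearMap.add_apply, LinearMap.smul_apply, hr, smul_add, neg_add]
    module
  | hgen y =>
  induction z using csv_induction with
  | h0 => simp
  | hadd r q hr hq => simp only [map_add, hr, hq]; abel
  | hsmul c r hr => simp only [map_smul, hr, smul_add]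
  | hX r hr =>
    simp only [sesqExt_X_right, X_add_C_smul, map_smul, map_add, hr, smul_add]
    module
  | hgen m =>
  cases x <;> cases y <;> rename_i i j <;>
    simp only [sesqExt_single, csvGenBracket, eval_one, one_comp, map_one, one_mul, one_smul,
      map_zero, LinearMap.zero_apply, smul_zero, add_zero, Finsupp.smul_single,
      smul_eq_mul, add_left_comm j i m, add_assoc i j m, ← Finsupp.single_add]
  case L.L =>
    congr 1
    refine Polynomial.funext fun x => ?_
    have := hf i j m x s t
    simp [eval_comp]
    linear_combination this
  case L.Y =>
    congr 1
    refine Polynomial.funext fun x => ?_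
    have := hd i j m x s t
    simp [eval_comp]
    linear_combination this
  case Y.L =>
    congr 1
    refine Polynomial.funext fun x => ?_
    have := hd j i m x t s
    simp [eval_comp]
    linear_combination -this
  case Y.Y =>
    rw [C_comp, C_comp, zero_add]

theorem isInternal_seriesGrading : DirectSum.IsInternal seriesGrading := by
  have hb : ∀ m, seriesGrading m =
      Submodule.span ℂ[X] {(Finsupp.basisSingleOne : Module.Basis ℤ ℂ[X] SeriesCarrier) m} := by
    intro m
    rw [Finsupp.coe_basisSingleOne, seriesGrading]
  rw [DirectSum.isInternal_submodule_iff_iSupIndep_and_iSup_eq_top]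
  simp only [funext hb]
  refine ⟨(Module.Basis.linearIndependent _).iSupIndep_span_singleton, ?_⟩
  rw [← Submodule.span_range_eq_iSup, Module.Basis.span_eq]

theorem seriesAction_mem {d : ℂ} {f : ℂ → ℤ → ℤ → ℂ[X]} (i j : ℤ) (r : CSVCarrier)
    (hr : r ∈ csvGrading i) (v : SeriesCarrier) (hv : v ∈ seriesGrading j) (t : ℂ) :
    seriesAction f d t r v ∈ seriesGrading (i + j) := by
  obtain ⟨q, rfl⟩ := Submodule.mem_span_singleton.1 hv
  have hmem : ∀ p : ℂ[X], Finsupp.single (i + j) p ∈ seriesGrading (i + j) := fun p =>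
    Submodule.mem_span_singleton.2 ⟨p, by simp⟩
  rw [csvGrading] at hr
  induction hr using Submodule.span_induction with
  | mem x hx =>
    rcases hx with rfl | rfl | rfl <;>
    · rw [Finsupp.smul_single, seriesAction, sesqExt_single]
      refine Submodule.smul_mem _ _ ?_
      first | exact hmem _ | exact Submodule.zero_mem _
  | zero => simp
  | add x y _ _ hx hy =>
    rw [map_add]
    exact Submodule.add_mem _ hx hy
  | smul p x _ hx =>
    induction p using Polynomial.induction_on generalizing x with
    | C c =>
      rw [C_smul_eq_smul, (seriesAction f d t).map_smul c x, LinearMap.smul_apply,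
        ← C_smul_eq_smul]
      exact Submodule.smul_mem _ _ hx
    | add p p' hp hp' =>
      rw [add_smul, map_add]
      exact Submodule.add_mem _ (hp x ‹_› hx) (hp' x ‹_› hx)
    | monomial n c ih =>
      rw [pow_succ, ← mul_assoc, mul_smul]
      refine ih _ (Submodule.smul_mem _ _ ‹_›) ?_
      rw [seriesAction, sesqExt_X_left, ← C_smul_eq_smul]
      exact Submodule.neg_mem _ (Submodule.smul_mem _ _ hx)

theorem isGradedFreeIntermediateSeries_seriesAction {a b d : ℂ} {f : ℂ → ℤ → ℤ → ℂ[X]}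
    (hpoly : ∀ i m, IsPolynomialFamily fun t => f t i m)
    (hf : ∀ i j m x s t, (f t j m).eval (x + s) * (f s i (j + m)).eval x -
      (f s i m).eval (x + t) * (f t j (i + m)).eval x = (s - t) * (f (s + t) (i + j) m).eval x)
    (hd : ∀ i j m x s t, d * (f s i (j + m)).eval x - (f s i m).eval (x + t) * d =
      (a / 2 * s - t + b / 2) * d) :
    IsGradedFreeIntermediateSeries (CSV a b) csvGrading (seriesAction f d) seriesGrading where
  isConformalModule :=
    { polynomial := isPolynomialFamily_sesqExt (by
        rintro (i | i | i) m
        · exact (hpoly i m).map (Finsupp.lsingle (i + m))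
        · exact isPolynomialFamily_zero
        · exact isPolynomialFamily_const _)
      sesq_left := fun t r v => sesqExt_X_left t _ r v
      sesq_right := fun t r v => sesqExt_X_right t _ r v
      commutator := seriesAction_commutator hf hd }
  isInternal := isInternal_seriesGrading
  act_mem i j r hr v hv t := seriesAction_mem i j r hr v hv t
  free_one i := ⟨Finsupp.single i 1, rfl, fun p hp => by simpa using hp⟩

theorem isPolynomialFamily_linear {V : Type*} [AddCommGroup V] [Module ℂ V] (v w : V) :
    IsPolynomialFamily fun t : ℂ => v + t • w :=
  (isPolynomialFamily_const v).add (isPolynomialFamily_const w).smul_self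

theorem isPolynomialFamily_coeffA (A : ℤ → Fin 2) (β : ℂ) (i m : ℤ) :
    IsPolynomialFamily fun t => coeffA A β t i m := by
  have h01 : ∀ k : Fin 2, k = 0 ∨ k = 1 := by decide
  unfold coeffA
  rcases h01 (A m) with h1 | h1 <;> rcases h01 (A (i + m)) with h2 | h2 <;> simp only [h1, h2]
  · exact isPolynomialFamily_const _
  · exact isPolynomialFamily_const _
  · have h := isPolynomialFamily_linear ((X + C β) * (X + C β) : ℂ[X]) (X + C β)
    simp only [smul_eq_C_mul] at h
    convert h using 2
    ring
  · have h := isPolynomialFamily_linear (X + C β : ℂ[X]) 1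
    simpa only [smul_eq_C_mul, mul_one] using h

theorem isGraded_actVd {a b d : ℂ} (α β : ℂ) (hd : d = 0 ∨ a = 0 ∧ b = 0) :
    IsGradedFreeIntermediateSeries (CSV a b) csvGrading (actVd α β d) seriesGrading := by
  refine isGradedFreeIntermediateSeries_seriesAction (fun i m => ?_) (fun i j m x s t => ?_)
    fun i j m x s t => ?_
  · have h := isPolynomialFamily_linear (X + C β : ℂ[X]) (C α)
    simp only [smul_eq_C_mul] at h
    convert h using 2
    rw [C_add, C_mul]
    ring
  · simp only [eval_add, eval_X, eval_C]
    ring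
  · rcases hd with rfl | ⟨rfl, rfl⟩
    · ring
    · simp only [eval_add, eval_X, eval_C]
      ring

theorem isGraded_actAd {a b d : ℂ} (A : ℤ → Fin 2) (β : ℂ)
    (hd : d = 0 ∨ (a = 0 ∧ b = 0) ∧ ∀ i j, A i = A j) :
    IsGradedFreeIntermediateSeries (CSV a b) csvGrading (actAd A β d) seriesGrading := by
  refine isGradedFreeIntermediateSeries_seriesAction (isPolynomialFamily_coeffA A β)
    (coeffA_relation A β) fun i j m x s t => ?_
  rcases hd with rfl | ⟨⟨rfl, rfl⟩, hA⟩
  · ring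
  · have h01 : ∀ k : Fin 2, k = 0 ∨ k = 1 := by decide
    unfold coeffA
    rcases h01 (A 0) with h1 | h1 <;>
      simp only [hA m 0, hA (i + m) 0, hA (j + m) 0, hA (i + (j + m)) 0, h1, eval_add, eval_X,
        eval_C] <;> ring

theorem isNontrivialAction_seriesAction {f : ℂ → ℤ → ℤ → ℂ[X]} {d : ℂ} (h : f 0 0 0 ≠ 0) :
    IsNontrivialAction (seriesAction f d) := by
  refine ⟨0, Finsupp.single (.L 0) 1, Finsupp.single 0 1, ?_⟩
  rw [seriesAction, sesqExt_single]
  simpa using h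

theorem isNontrivialAction_actVd (α β d : ℂ) : IsNontrivialAction (actVd α β d) :=
  isNontrivialAction_seriesAction (X_add_C_ne_zero _)

theorem isNontrivialAction_actAd (A : ℤ → Fin 2) (β d : ℂ) :
    IsNontrivialAction (actAd A β d) := by
  refine isNontrivialAction_seriesAction ?_
  have h01 : ∀ k : Fin 2, k = 0 ∨ k = 1 := by decide
  unfold coeffA
  rcases h01 (A 0) with h1 | h1 <;> simp only [h1, add_zero, C_0] <;> exact X_add_C_ne_zero _

/-- `L_0` acts on `v_m` by `∂ + β + a_m λ`. For `a = b = 0`, the commutator of `L_0` at `λ = 1` with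
`Y_{j-m}` at `λ = 0` must vanish on `v_m`, but it equals `d (a_j - a_m) v_j`. -/
theorem eq_zero_or_const_of_isGraded_actAd {A : ℤ → Fin 2} {β d : ℂ}
    (h : IsConformalModule (CSV 0 0) (actAd A β d)) : d = 0 ∨ ∀ i j, A i = A j := by
  have h01 : ∀ k : Fin 2, k = 0 ∨ k = 1 := by decide
  by_contra! hcon
  obtain ⟨hd, j, m, hne⟩ := hcon
  have h1 := h.commutator 1 0 (Finsupp.single (.L 0) 1) (Finsupp.single (.Y (j - m)) 1)
    (Finsupp.single m 1)
  change actAd A β d 1 _ _ - _ = actAd A β d (1 + 0) (sesqExt 1 (csvGenBracket 0 0 1) _ _) _ at h1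
  simp only [actAd, seriesAction, sesqExt_single, csvGenBracket, Finsupp.smul_single, zero_add,
    sub_add_cancel, ← Finsupp.single_sub, coeffA] at h1
  have h2 := congrArg (fun v => (v j).eval 0) h1
  rcases h01 (A m) with h3 | h3 <;> rcases h01 (A j) with h4 | h4
  · exact hne (h4.trans h3.symm)
  · simp [h3, h4] at h2
    exact hd (by linear_combination h2)
  · simp [h3, h4] at h2
    exact hd (by linear_combination -h2)
  · exact hne (h4.trans h3.symm)

end

theorem mainTheorem2 (a b : ℂ) :
    (∀ (V : Type*) [AddCommGroup V] [Module ℂ V] [Module ℂ[X] V] [IsScalarTower ℂ ℂ[X] V]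
        (act : ℂ → CSVCarrier →ₗ[ℂ] V →ₗ[ℂ] V) (VV : ℤ → Submodule ℂ[X] V),
        IsGradedFreeIntermediateSeries (CSV a b) csvGrading act VV → IsNontrivialAction act →
        ((a ≠ 0 ∨ b ≠ 0) →
          (∃ α β : ℂ, GradedConformalIso act VV (actV α β) seriesGrading) ∨
          (∃ (A : ℤ → Fin 2) (β : ℂ), GradedConformalIso act VV (actA A β) seriesGrading)) ∧
        ((a = 0 ∧ b = 0) →
          (∃ α β d : ℂ, GradedConformalIso act VV (actVd α β d) seriesGrading) ∨
          (∃ (A : ℤ → Fin 2) (β d : ℂ), (d = 0 ∨ ∀ i j, A i = A j) ∧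
            GradedConformalIso act VV (actAd A β d) seriesGrading))) ∧
    (∀ α β : ℂ,
      IsGradedFreeIntermediateSeries (CSV a b) csvGrading (actV α β) seriesGrading ∧
        IsNontrivialAction (actV α β)) ∧
    (∀ (A : ℤ → Fin 2) (β : ℂ),
      IsGradedFreeIntermediateSeries (CSV a b) csvGrading (actA A β) seriesGrading ∧
        IsNontrivialAction (actA A β)) ∧
    ((a = 0 ∧ b = 0) →
      (∀ α β d : ℂ,
        IsGradedFreeIntermediateSeries (CSV a b) csvGrading (actVd α β d) seriesGrading ∧
          IsNontrivialAction (actVd α β d)) ∧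
      (∀ (A : ℤ → Fin 2) (β d : ℂ),
        (IsGradedFreeIntermediateSeries (CSV a b) csvGrading (actAd A β d) seriesGrading ∧
          IsNontrivialAction (actAd A β d)) ↔ (d = 0 ∨ ∀ i j, A i = A j))) := by
  refine ⟨fun V _ _ _ _ act VV h hact => ?_, fun α β => ?_, fun A β => ?_, fun hab => ⟨?_, ?_⟩⟩
  · obtain ⟨β, d, hd, hcases⟩ := classification h hact
    refine ⟨fun hab => ?_, fun _ => ?_⟩
    · obtain rfl := hd hab
      rcases hcases with ⟨α, hα⟩ | ⟨A, -, hA⟩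
      · exact Or.inl ⟨α, β, hα⟩
      · exact Or.inr ⟨A, β, hA⟩
    · rcases hcases with ⟨α, hα⟩ | ⟨A, -, hA⟩
      · exact Or.inl ⟨α, β, d, hα⟩
      · exact Or.inr ⟨A, β, 0, Or.inl rfl, hA⟩
  · exact ⟨isGraded_actVd α β (Or.inl rfl), isNontrivialAction_actVd α β 0⟩
  · exact ⟨isGraded_actAd A β (Or.inl rfl), isNontrivialAction_actAd A β 0⟩
  · exact fun α β d => ⟨isGraded_actVd α β (Or.inr hab), isNontrivialAction_actVd α β d⟩
  · intro A β d
    refine ⟨fun h => ?_, fun h => ⟨isGraded_actAd A β (h.imp_right fun hA => ⟨hab, hA⟩),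
      isNontrivialAction_actAd A β d⟩⟩
    obtain ⟨rfl, rfl⟩ := hab
    exact eq_zero_or_const_of_isGraded_actAd h.1.isConformalModule
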